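/- Let $B=(B(i,j))_{i,j\in\mathbb N}$ be a matrix of zeros and ones with no zero row and no zero column, let $\Sigma=\{(x_n)_{n\ge 1}\in\mathbb N^{\mathbb N}: B(x_n,x_{n+1})=1\text{ for all }n\}$, and let $\sigma(x_1,x_2,\dots)=(x_2,x_3,\dots)$ be the shift. Endow $\Sigma$ with the metric $d$ given by $d(x,x)=0$ and, for $x\neq y$, $d(x,y)=2^{-k}$, where $k\ge 0$ is the length of the longest common initial word of $x$ and $y$. Assume that $(\Sigma,\sigma)$ is transitive: for all non-empty open sets $U,V\subset\Sigma$ there is $n$ with $U\cap\sigma^{-n}V\neq\emptyset$. Let $\tau:\Sigma\to\mathbb R$ be a positive function in the class $\mathcal R$, that is, $\tau$ is uniformly continuous and bounded away from zero, $\mathrm{var}_2(\tau)=\sup\{|\tau(x)-\tau(y)|: d(x,y)\le 2^{-2}\}<\infty$, and $\lim_{k\to\infty}\inf\{\tau(x): x_1\ge k\}=\infty$. Let $Y$ be the space $\{(x,t)\in\Sigma\times\mathbb R: 0\le t\le\tau(x)\}$ with $(x,\tau(x))$ and $(\sigma(x),0)$ identified for every $x\in\Sigma$, with the quotient topology, and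 let $(\theta_t)_{t\ge 0}$ be the suspension semi-flow on $Y$: the semi-flow with $\theta_t(x,s)=(x,s+t)$ whenever $s+t\in[0,\tau(x)]$. Let $\mathcal M(\Sigma,\sigma,\tau)$ be the set of Borel probability measures $\nu$ on $Y$ with $\nu(\theta_t^{-1}A)=\nu(A)$ for all $t\ge 0$ and all Borel sets $A$, and let $\mathcal M_e(\Sigma,\sigma,\tau)$ be the set of those $\nu\in\mathcal M(\Sigma,\sigma,\tau)$ that are ergodic, that is, $\nu(A)\in\{0,1\}$ for every Borel set $A$ with $\theta_t^{-1}A=A$ for all $t\ge 0$. Then $\mathcal M_e(\Sigma,\sigma,\tau)$ is dense in $\mathcal M(\Sigma,\sigma,\tau)$ with respect to the weak* topology, the coarsest topology for which $\nu\mapsto\int f\,d\nu$ is continuous for every bounded continuous $f:Y\to\mathbb R$. -/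

import Mathlib

open MeasureTheory Filter Topology
open scoped NNReal ENNReal

namespace MarkovSuspension

noncomputable section

/-! ### Countable Markov shifts -/

/-- A transition matrix on the alphabet of natural numbers: its entries are zeros and ones, and
no row and no column is made entirely of zeros. -/
structure IsTransitionMatrix (B : Matrix ℕ ℕ ℕ) : Prop where
  zero_or_one : ∀ i j, B i j = 0 ∨ B i j = 1
  row : ∀ i, ∃ j, B i j = 1
  column : ∀ j, ∃ i, B i j = 1

/-- The one-sided countable Markov shift space defined by the matrix `B`. Coordinates are
indexed from `0`. -/
def Shift (B : Matrix ℕ ℕ ℕ) : Type :=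
  {x : ℕ → ℕ // ∀ n, B (x n) (x (n + 1)) = 1}

/-- The metric for which `dist x y = 2 ^ (-k)`, where `k` is the first index with `x k ≠ y k`
(see `Shift.dist_eq`). -/
instance (B : Matrix ℕ ℕ ℕ) : MetricSpace (Shift B) :=
  MetricSpace.induced Subtype.val Subtype.val_injective PiNat.metricSpaceNatNat

theorem Shift.dist_eq {B : Matrix ℕ ℕ ℕ} (x y : Shift B) (h : x ≠ y) :
    dist x y = (1 / 2 : ℝ) ^ PiNat.firstDiff x.1 y.1 :=
  PiNat.dist_eq_of_ne (E := fun _ => ℕ) (fun h' => h (Subtype.ext h'))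

/-- Two points are at distance at most `2 ^ (-n)` exactly when their first `n` coordinates
agree. -/
theorem Shift.dist_le_iff {B : Matrix ℕ ℕ ℕ} (x y : Shift B) (n : ℕ) :
    dist x y ≤ (1 / 2 : ℝ) ^ n ↔ ∀ i < n, x.1 i = y.1 i :=
  (PiNat.mem_cylinder_iff_dist_le (E := fun _ => ℕ) (x := y.1) (y := x.1) (n := n)).symm

/-- The shift map. -/
def shiftMap {B : Matrix ℕ ℕ ℕ} (x : Shift B) : Shift B :=
  ⟨fun n => x.1 (n + 1), fun n => x.2 (n + 1)⟩

/-- Transitivity: for all non-empty open sets `U`, `V` some `U ∩ σ^{-n} V` is non-empty. -/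
def IsTransitive (B : Matrix ℕ ℕ ℕ) : Prop :=
  ∀ U V : Set (Shift B), IsOpen U → U.Nonempty → IsOpen V → V.Nonempty →
    ∃ n : ℕ, (U ∩ (shiftMap^[n]) ⁻¹' V).Nonempty

/-- The `n`-th variation: the supremum of `|φ x - φ y|` over `dist x y ≤ 2 ^ (-n)`. -/
def variation {B : Matrix ℕ ℕ ℕ} (n : ℕ) (φ : Shift B → ℝ) : ℝ≥0∞ :=
  ⨆ (x : Shift B) (y : Shift B) (_ : dist x y ≤ (1 / 2 : ℝ) ^ n), ENNReal.ofReal |φ x - φ y|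

def IsBoundedAwayFromZero {B : Matrix ℕ ℕ ℕ} (τ : Shift B → ℝ) : Prop :=
  ∃ c : ℝ, 0 < c ∧ ∀ x, c ≤ τ x

/-- The class `𝓡` of roof functions. -/
structure ClassR {B : Matrix ℕ ℕ ℕ} (τ : Shift B → ℝ) : Prop where
  pos : ∀ x, 0 < τ x
  uniformContinuous : UniformContinuous τ
  boundedAwayFromZero : IsBoundedAwayFromZero τ
  variation_two : variation 2 τ < ∞
  tendsto_inf : Tendsto (fun k : ℕ => sInf (τ '' {x : Shift B | k ≤ x.1 0})) atTop atTop

/-! ### The suspension space -/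

/-- The region `{(x, t) : 0 ≤ t ≤ τ x}` under the roof, before the identification. -/
abbrev Strip {B : Matrix ℕ ℕ ℕ} (τ : Shift B → ℝ) : Type :=
  {p : Shift B × ℝ // 0 ≤ p.2 ∧ p.2 ≤ τ p.1}

/-- The relation that relates `(x, τ x)` to `(σ x, 0)`. -/
def roofRel {B : Matrix ℕ ℕ ℕ} (τ : Shift B → ℝ) (p q : Strip τ) : Prop :=
  p.1.2 = τ p.1.1 ∧ q.1.1 = shiftMap p.1.1 ∧ q.1.2 = 0

/-- The suspension space: `Strip τ` with `(x, τ x)` and `(σ x, 0)` identified for every `x`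
(`Quot` divides by the equivalence relation that `roofRel τ` generates). -/
def Suspension {B : Matrix ℕ ℕ ℕ} (τ : Shift B → ℝ) : Type :=
  Quot (roofRel τ)

/-- The quotient topology. -/
instance {B : Matrix ℕ ℕ ℕ} (τ : Shift B → ℝ) : TopologicalSpace (Suspension τ) :=
  inferInstanceAs (TopologicalSpace (Quot (roofRel τ)))

instance {B : Matrix ℕ ℕ ℕ} (τ : Shift B → ℝ) : MeasurableSpace (Suspension τ) :=
  borel _

instance {B : Matrix ℕ ℕ ℕ} (τ : Shift B → ℝ) : BorelSpace (Suspension τ) :=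
  ⟨rfl⟩

/-- The point of the suspension space represented by `(x, t)` with `0 ≤ t ≤ τ x`. -/
def Suspension.mk {B : Matrix ℕ ℕ ℕ} {τ : Shift B → ℝ} (x : Shift B) (t : ℝ)
    (h₀ : 0 ≤ t) (h₁ : t ≤ τ x) : Suspension τ :=
  Quot.mk _ ⟨(x, t), h₀, h₁⟩

/-! ### The suspension semi-flow -/

theorem exists_lt_birkhoffSum {B : Matrix ℕ ℕ ℕ} {τ : Shift B → ℝ}
    (hτ : IsBoundedAwayFromZero τ) (x : Shift B) (u : ℝ) :
    ∃ n : ℕ, u < birkhoffSum shiftMap τ (n + 1) x := by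
  obtain ⟨c, hc, h⟩ := hτ
  obtain ⟨n, hn⟩ := exists_nat_gt (u / c)
  refine ⟨n, ?_⟩
  have h1 : ((n + 1 : ℕ) : ℝ) * c ≤ birkhoffSum shiftMap τ (n + 1) x := by
    have := Finset.card_nsmul_le_sum (Finset.range (n + 1))
      (fun k => τ (shiftMap^[k] x)) c (fun k _ => h _)
    simpa [birkhoffSum] using this
  rw [div_lt_iff₀ hc] at hn
  push_cast at h1
  nlinarith

open Classical in
/-- The number of returns to the base within time `u ≥ 0` of the orbit that starts at `(x, 0)`:
the `n` with `S_n τ x ≤ u < S_{n+1} τ x`, where `S_n τ` are the Birkhoff sums of `τ`. -/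
def returns {B : Matrix ℕ ℕ ℕ} {τ : Shift B → ℝ} (hτ : IsBoundedAwayFromZero τ)
    (x : Shift B) (u : ℝ) : ℕ :=
  Nat.find (exists_lt_birkhoffSum hτ x u)

theorem lt_birkhoffSum_returns {B : Matrix ℕ ℕ ℕ} {τ : Shift B → ℝ}
    (hτ : IsBoundedAwayFromZero τ) (x : Shift B) (u : ℝ) :
    u < birkhoffSum shiftMap τ (returns hτ x u + 1) x := by
  classical
  exact Nat.find_spec (exists_lt_birkhoffSum hτ x u)

theorem birkhoffSum_returns_le {B : Matrix ℕ ℕ ℕ} {τ : Shift B → ℝ}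
    (hτ : IsBoundedAwayFromZero τ) (x : Shift B) (u : ℝ) (hu : 0 ≤ u) :
    birkhoffSum shiftMap τ (returns hτ x u) x ≤ u := by
  classical
  rcases hn : returns hτ x u with _ | n
  · simpa using hu
  · have h : n < returns hτ x u := by omega
    exact not_lt.1 (Nat.find_min (exists_lt_birkhoffSum hτ x u) h)

/-- The point that the orbit of `(x, 0)` reaches at time `u ≥ 0`. -/
def orbitPoint {B : Matrix ℕ ℕ ℕ} {τ : Shift B → ℝ} (hτ : IsBoundedAwayFromZero τ)
    (x : Shift B) (u : ℝ) (hu : 0 ≤ u) : Suspension τ :=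
  Suspension.mk (shiftMap^[returns hτ x u] x)
    (u - birkhoffSum shiftMap τ (returns hτ x u) x)
    (sub_nonneg.2 (birkhoffSum_returns_le hτ x u hu))
    (by
      have h := lt_birkhoffSum_returns hτ x u
      rw [birkhoffSum_succ] at h
      linarith)

theorem orbitPoint_roof_add {B : Matrix ℕ ℕ ℕ} {τ : Shift B → ℝ}
    (hτ : IsBoundedAwayFromZero τ) (x : Shift B) (u : ℝ) (hu : 0 ≤ u) (hu' : 0 ≤ τ x + u) :
    orbitPoint hτ x (τ x + u) hu' = orbitPoint hτ (shiftMap x) u hu := by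
  classical
  have hr : returns hτ x (τ x + u) = returns hτ (shiftMap x) u + 1 := by
    refine (Nat.find_eq_iff _).2 ⟨?_, fun m hm => ?_⟩
    · rw [birkhoffSum_succ']
      have := lt_birkhoffSum_returns hτ (shiftMap x) u
      linarith
    · rw [birkhoffSum_succ', not_lt]
      rcases m with _ | m
      · simpa using hu
      · have := not_lt.1 (Nat.find_min (exists_lt_birkhoffSum hτ (shiftMap x) u)
          (show m < returns hτ (shiftMap x) u by omega))
        linarith
  unfold orbitPoint Suspension.mk
  congr 1
  refine Subtype.ext (Prod.ext ?_ ?_)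
  · change shiftMap^[returns hτ x (τ x + u)] x = shiftMap^[returns hτ (shiftMap x) u] (shiftMap x)
    rw [hr]
    rfl
  · change τ x + u - birkhoffSum shiftMap τ (returns hτ x (τ x + u)) x =
      u - birkhoffSum shiftMap τ (returns hτ (shiftMap x) u) (shiftMap x)
    rw [hr, birkhoffSum_succ']
    ring

/-- The suspension semi-flow `(θ_t)_{t ≥ 0}` over the shift with roof function `τ`: a point
`(x, s)` moves upwards at unit speed and passes from `(x, τ x)` to `(σ x, 0)`. -/
def flow {B : Matrix ℕ ℕ ℕ} {τ : Shift B → ℝ} (hτ : IsBoundedAwayFromZero τ) (t : ℝ≥0) :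
    Suspension τ → Suspension τ :=
  Quot.lift (fun p : Strip τ => orbitPoint hτ p.1.1 (p.1.2 + t) (add_nonneg p.2.1 t.2)) (by
    rintro ⟨⟨x, s⟩, hs₀, hs₁⟩ ⟨⟨y, r⟩, hr₀, hr₁⟩ ⟨h₁, h₂, h₃⟩
    dsimp only at h₁ h₂ h₃ ⊢
    subst h₁ h₂ h₃
    simp only [zero_add]
    exact orbitPoint_roof_add hτ x t t.2 _)

/-- The formula that defines the semi-flow below the roof. -/
theorem flow_mk {B : Matrix ℕ ℕ ℕ} {τ : Shift B → ℝ} (hτ : IsBoundedAwayFromZero τ) (t : ℝ≥0)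
    (x : Shift B) (s : ℝ) (h₀ : 0 ≤ s) (h₁ : s ≤ τ x) (h : s + t ≤ τ x) :
    flow hτ t (Suspension.mk x s h₀ h₁) =
      Suspension.mk x (s + t) (add_nonneg h₀ t.2) h := by
  classical
  have key : ∀ (y : Shift B) (u : ℝ) (hu : 0 ≤ u) (hu' : u < τ y),
      orbitPoint hτ y u hu = Suspension.mk y u hu hu'.le := by
    intro y u hu hu'
    have hr : returns hτ y u = 0 := (Nat.find_eq_zero _).2 (by simpa using hu')
    unfold orbitPoint Suspension.mk
    congr 1
    refine Subtype.ext (Prod.ext ?_ ?_)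
    · change shiftMap^[returns hτ y u] y = y
      rw [hr]
      rfl
    · change u - birkhoffSum shiftMap τ (returns hτ y u) y = u
      rw [hr]
      simp
  change orbitPoint hτ x (s + t) (add_nonneg h₀ t.2) = _
  rcases h.lt_or_eq with h' | h'
  · exact key x _ _ h'
  · have hpos : ∀ y, 0 < τ y := fun y => hτ.choose_spec.1.trans_le (hτ.choose_spec.2 y)
    have e : orbitPoint hτ x (s + t) (add_nonneg h₀ t.2) =
        orbitPoint hτ (shiftMap x) 0 le_rfl := by
      rw [← orbitPoint_roof_add hτ x 0 le_rfl (by simpa using (hpos x).le)]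
      congr 1
      simpa using h'
    rw [e, key _ 0 le_rfl (hpos _)]
    exact (Quot.sound ⟨h', rfl, rfl⟩).symm

theorem orbitPoint_birkhoffSum_add {B : Matrix ℕ ℕ ℕ} {τ : Shift B → ℝ}
    (hτ : IsBoundedAwayFromZero τ) (n : ℕ) (x : Shift B) (u v : ℝ) (hu : 0 ≤ u) (hv : 0 ≤ v)
    (h : v = birkhoffSum shiftMap τ n x + u) :
    orbitPoint hτ x v hv = orbitPoint hτ (shiftMap^[n] x) u hu := by
  have hpos : ∀ y, 0 ≤ τ y := fun y =>
    (hτ.choose_spec.1.trans_le (hτ.choose_spec.2 y)).le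
  induction n generalizing x v with
  | zero =>
    have hvu : v = u := by simpa using h
    subst hvu
    rfl
  | succ n ih =>
    rw [birkhoffSum_succ'] at h
    have hw : 0 ≤ birkhoffSum shiftMap τ n (shiftMap x) + u :=
      add_nonneg (Finset.sum_nonneg fun k _ => hpos _) hu
    have hv' : v = τ x + (birkhoffSum shiftMap τ n (shiftMap x) + u) := by linarith
    subst hv'
    rw [orbitPoint_roof_add hτ x _ hw hv, ih (shiftMap x) _ hw rfl]
    rfl

/-- The semigroup property; with `flow_mk` it determines the semi-flow. -/
theorem flow_flow {B : Matrix ℕ ℕ ℕ} {τ : Shift B → ℝ} (hτ : IsBoundedAwayFromZero τ)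
    (t r : ℝ≥0) (y : Suspension τ) : flow hτ t (flow hτ r y) = flow hτ (r + t) y := by
  induction y using Quot.ind with
  | _ p =>
    obtain ⟨⟨x, s⟩, h₀, h₁⟩ := p
    have hs : 0 ≤ s + (r : ℝ) := add_nonneg h₀ r.2
    refine (orbitPoint_birkhoffSum_add hτ (returns hτ x (s + r)) x
      (s + r - birkhoffSum shiftMap τ (returns hτ x (s + r)) x + t) (s + ((r + t : ℝ≥0) : ℝ))
      (add_nonneg (sub_nonneg.2 (birkhoffSum_returns_le hτ x _ hs)) t.2)
      (add_nonneg h₀ (r + t).2) ?_).symm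
    push_cast
    ring

/-! ### Invariant and ergodic measures of the semi-flow -/

/-- The Borel probability measures on the suspension space that are invariant under the
semi-flow. -/
def invariantMeasures {B : Matrix ℕ ℕ ℕ} {τ : Shift B → ℝ} (hτ : IsBoundedAwayFromZero τ) :
    Set (ProbabilityMeasure (Suspension τ)) :=
  {ν | ∀ t : ℝ≥0, ∀ A : Set (Suspension τ), MeasurableSet A →
    (ν : Measure (Suspension τ)) (flow hτ t ⁻¹' A) = (ν : Measure (Suspension τ)) A}

/-- The ergodic measures: the invariant probability measures for which every Borel set that is
invariant under the whole semi-flow has measure `0` or `1`. -/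
def ergodicMeasures {B : Matrix ℕ ℕ ℕ} {τ : Shift B → ℝ} (hτ : IsBoundedAwayFromZero τ) :
    Set (ProbabilityMeasure (Suspension τ)) :=
  {ν | ν ∈ invariantMeasures hτ ∧ ∀ A : Set (Suspension τ), MeasurableSet A →
    (∀ t : ℝ≥0, flow hτ t ⁻¹' A = A) →
      (ν : Measure (Suspension τ)) A = 0 ∨ (ν : Measure (Suspension τ)) A = 1}

end

end MarkovSuspension

open MarkovSuspension

namespace MarkovSuspension

noncomputable section

section

variable {B : Matrix ℕ ℕ ℕ} {τ : Shift B → ℝ}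

/-! ### The shift space -/

/-! Every invariant `ν` is a weak* limit of measures carried by single closed orbits, which are
trivially ergodic. Neither the ergodic theorem nor the ergodic decomposition is needed: invariance
and Fubini give the mean of a flow integral over time `T`, and this mean is approximated by finite
sampling.

Fix a bounded continuous vector-valued `f` on the suspension. A finite uniform average of `∫₀ᵀ f`
along flow segments approximates `T • ∫ f dν` (`exists_sample`, `integral_integral_flow`). The base
word of each segment is extended to a loop at the symbol `0`, using transitivity
(`exists_loopApprox`); the loops are concatenated and the result is repeated periodically
(`PathApprox.trans`, `PathApprox.exists_periodic`).

Two errors must be small per unit time. A point that follows the same word has fiber integrals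
differing by at most the oscillation on cylinders of length `L`. Spread evenly over fibers, this
oscillation is a function on the suspension, bounded uniformly in `L` since the second variation of
`τ` is finite and `τ` is bounded below; hence its `ν`-mean tends to `0`, and it can be sampled
together with `f`. The connecting words cost an amount depending only on the two endpoints of the
segment. By invariance both endpoints have law `ν`, so off a set of small measure the cost is
bounded independently of `T`, and a large `T` makes it negligible (`exists_periodic_near`).

The sampled time need not be the period of the closed orbit. Adding the constant `1` to the test
functions forces their ratio to be close to `1` (`exists_ergodic_near`). -/

instance : MeasurableSpace (Shift B) := borel _

instance : BorelSpace (Shift B) := ⟨rfl⟩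

theorem Shift.isInducing_val : IsInducing (Subtype.val : Shift B → ℕ → ℕ) := ⟨rfl⟩

instance : SecondCountableTopology (Shift B) :=
  Shift.isInducing_val.secondCountableTopology

theorem Shift.continuous_coord (i : ℕ) : Continuous fun x : Shift B => x.1 i :=
  (continuous_apply i).comp Shift.isInducing_val.continuous

theorem continuous_shiftMap : Continuous (shiftMap : Shift B → Shift B) :=
  Shift.isInducing_val.continuous_iff.2 (continuous_pi fun i => Shift.continuous_coord (i + 1))

theorem shiftMap_iterate_coord (n i : ℕ) (x : Shift B) :
    ((shiftMap^[n] x).1 i) = x.1 (n + i) := by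
  induction n generalizing x with
  | zero => simp
  | succ n ih =>
    rw [Function.iterate_succ_apply, ih]
    change x.1 (n + i + 1) = _
    rw [Nat.add_right_comm]

theorem Shift.isOpen_agree (x : Shift B) (n : ℕ) :
    IsOpen {y : Shift B | ∀ i < n, y.1 i = x.1 i} := by
  have : {y : Shift B | ∀ i < n, y.1 i = x.1 i} =
      ⋂ i ∈ Finset.range n, {y : Shift B | y.1 i = x.1 i} := by
    ext y; simp
  rw [this]
  exact isOpen_biInter_finset fun i _ =>
    (isOpen_discrete {x.1 i}).preimage (Shift.continuous_coord i)

theorem continuous_birkhoffSum {E : Type*} [AddCommMonoid E] [TopologicalSpace E]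
    [ContinuousAdd E] {φ : Shift B → E} (hφ : Continuous φ) (n : ℕ) :
    Continuous (birkhoffSum shiftMap φ n) := by
  unfold birkhoffSum
  exact continuous_finsetSum _ fun i _ => hφ.comp (continuous_shiftMap.iterate i)

/-! ### Orbits and the canonical lift -/

theorem IsBoundedAwayFromZero.pos (hτ : IsBoundedAwayFromZero τ) (x : Shift B) : 0 < τ x :=
  hτ.choose_spec.1.trans_le (hτ.choose_spec.2 x)

theorem orbitPoint_eq_mk (hτ : IsBoundedAwayFromZero τ) (x : Shift B) (u : ℝ) (h₀ : 0 ≤ u)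
    (h₁ : u ≤ τ x) : orbitPoint hτ x u h₀ = Suspension.mk x u h₀ h₁ := by
  have hu : ((u.toNNReal : ℝ≥0) : ℝ) = u := Real.coe_toNNReal u h₀
  have h := flow_mk hτ u.toNNReal x 0 le_rfl (hτ.pos x).le (by simpa [hu] using h₁)
  simp only [hu, zero_add] at h
  rw [← h]
  change _ = orbitPoint hτ x (0 + u.toNNReal) (by positivity)
  simp [hu]

/-- The point that the orbit of `(x, 0)` reaches at time `max u 0`. -/
def orbit (hτ : IsBoundedAwayFromZero τ) (x : Shift B) (u : ℝ) : Suspension τ :=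
  orbitPoint hτ x (max u 0) (le_max_right _ _)

theorem orbit_of_nonneg (hτ : IsBoundedAwayFromZero τ) (x : Shift B) {u : ℝ} (hu : 0 ≤ u) :
    orbit hτ x u = orbitPoint hτ x u hu := by
  unfold orbit
  congr 1
  exact max_eq_left hu

theorem orbit_eq_mk (hτ : IsBoundedAwayFromZero τ) (x : Shift B) (u : ℝ) (h₀ : 0 ≤ u)
    (h₁ : u ≤ τ x) : orbit hτ x u = Suspension.mk x u h₀ h₁ := by
  rw [orbit_of_nonneg hτ x h₀, orbitPoint_eq_mk]

theorem orbit_birkhoffSum_add (hτ : IsBoundedAwayFromZero τ) (n : ℕ) (x : Shift B) {u : ℝ}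
    (hu : 0 ≤ u) : orbit hτ x (birkhoffSum shiftMap τ n x + u) = orbit hτ (shiftMap^[n] x) u := by
  have h : 0 ≤ birkhoffSum shiftMap τ n x + u :=
    add_nonneg (Finset.sum_nonneg fun k _ => (hτ.pos _).le) hu
  rw [orbit_of_nonneg hτ x h, orbit_of_nonneg hτ _ hu]
  exact orbitPoint_birkhoffSum_add hτ n x u _ hu h rfl

theorem nsmul_le_birkhoffSum {c : ℝ} (h : ∀ x, c ≤ τ x) (n : ℕ) (x : Shift B) :
    n * c ≤ birkhoffSum shiftMap τ n x := by
  simpa [birkhoffSum] using Finset.card_nsmul_le_sum (Finset.range n)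
    (fun k => τ (shiftMap^[k] x)) c (fun k _ => h _)

/-- The closed sets on which the time lies between consecutive Birkhoff sums form a cover, locally
finite because `S n` grows at least like `n * c`. On each of them the orbit factors continuously
through `Strip τ`; the roof identification makes the pieces agree on overlaps. -/
theorem continuous_orbit (hτ : IsBoundedAwayFromZero τ) (hc : Continuous τ) :
    Continuous fun p : Shift B × ℝ => orbit hτ p.1 p.2 := by
  let S : ℕ → Shift B → ℝ := birkhoffSum shiftMap τ
  have hS : ∀ n, Continuous (S n) := continuous_birkhoffSum hc
  let A : ℕ → Set (Shift B × ℝ) := fun n => {p | S n p.1 ≤ max p.2 0 ∧ max p.2 0 ≤ S (n + 1) p.1}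
  have hmax : Continuous fun p : Shift B × ℝ => max p.2 0 := by fun_prop
  refine LocallyFinite.continuous (f := A) ?_ ?_ ?_ ?_
  · rintro ⟨x, u⟩
    obtain ⟨c, hc0, hcτ⟩ := hτ
    refine ⟨{p | p.2 < max (u + 1) 0 + 1}, (isOpen_lt continuous_snd continuous_const).mem_nhds
      (by simp only [Set.mem_ofPred_eq]; linarith [le_max_left (u + 1) 0]), ?_⟩
    obtain ⟨N, hN⟩ := exists_nat_gt ((max (u + 1) 0 + 1) / c)
    rw [div_lt_iff₀ hc0] at hN
    refine (Set.finite_lt_nat N).subset ?_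
    rintro n ⟨⟨y, v⟩, ⟨h1, -⟩, h2⟩
    simp only [Set.mem_ofPred_eq] at h1 h2 ⊢
    have h3 := nsmul_le_birkhoffSum hcτ n y
    have h4 : max v 0 < max (u + 1) 0 + 1 := max_lt h2 (by positivity)
    have h5 : (n : ℝ) * c < N * c := by
      change _ ≤ S n y at h3
      linarith
    exact_mod_cast lt_of_mul_lt_mul_right h5 hc0.le
  · refine Set.eq_univ_of_forall fun p => Set.mem_iUnion.2 ⟨returns hτ p.1 (max p.2 0), ?_, ?_⟩
    · exact birkhoffSum_returns_le hτ _ _ (le_max_right _ _)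
    · exact (lt_birkhoffSum_returns hτ _ _).le
  · intro n
    exact (isClosed_le ((hS n).comp continuous_fst) hmax).inter
      (isClosed_le hmax ((hS (n + 1)).comp continuous_fst))
  · intro n
    rw [continuousOn_iff_continuous_domRestrict]
    have hmem : ∀ p : A n, 0 ≤ max p.1.2 0 - S n p.1.1 ∧
        max p.1.2 0 - S n p.1.1 ≤ τ (shiftMap^[n] p.1.1) := by
      rintro ⟨⟨x, u⟩, h1, h2⟩
      simp only at h1 h2 ⊢
      have : S (n + 1) x = S n x + τ (shiftMap^[n] x) := birkhoffSum_succ _ _ _ _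
      constructor <;> linarith
    have : (A n).domRestrict (fun p : Shift B × ℝ => orbit hτ p.1 p.2) =
        Quot.mk (roofRel τ) ∘ fun p : A n =>
          (⟨(shiftMap^[n] p.1.1, max p.1.2 0 - S n p.1.1), hmem p⟩ : Strip τ) := by
      funext p
      change orbit hτ p.1.1 p.1.2 = Suspension.mk _ _ (hmem p).1 (hmem p).2
      rw [← orbit_eq_mk hτ, ← orbit_birkhoffSum_add hτ n _ (hmem p).1, add_sub_cancel]
      unfold orbit
      simp
    rw [this]
    refine continuous_quot_mk.comp (Continuous.subtype_mk ?_ _)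
    exact ((continuous_shiftMap.iterate n).comp (continuous_fst.comp continuous_subtype_val)).prodMk
      ((hmax.comp continuous_subtype_val).sub
        ((hS n).comp (continuous_fst.comp continuous_subtype_val)))

theorem flow_orbit (hτ : IsBoundedAwayFromZero τ) (t : ℝ≥0) (x : Shift B) {u : ℝ} (hu : 0 ≤ u) :
    flow hτ t (orbit hτ x u) = orbit hτ x (u + t) := by
  have key : ∀ v : ℝ, 0 ≤ v → orbit hτ x v =
      flow hτ v.toNNReal (Suspension.mk x 0 le_rfl (hτ.pos x).le) := by
    intro v hv
    rw [orbit_of_nonneg hτ x hv]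
    change _ = orbitPoint hτ x (0 + v.toNNReal) (by positivity)
    simp [hv]
  rw [key u hu, flow_flow, key (u + t) (by positivity),
    Real.toNNReal_add hu t.coe_nonneg, Real.toNNReal_coe]

theorem continuous_flow (hτ : IsBoundedAwayFromZero τ) (hc : Continuous τ) (t : ℝ≥0) :
    Continuous (flow hτ t) := by
  refine continuous_quot_lift _ ?_
  have : (fun p : Strip τ => orbitPoint hτ p.1.1 (p.1.2 + t) (add_nonneg p.2.1 t.2)) =
      fun p : Strip τ => orbit hτ p.1.1 (p.1.2 + t) :=
    funext fun p => (orbit_of_nonneg hτ _ _).symm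
  rw [this]
  exact (continuous_orbit hτ hc).comp (((continuous_fst.comp continuous_subtype_val)).prodMk
    ((continuous_snd.comp continuous_subtype_val).add continuous_const))

open Classical in
/-- The representative `(x, t)` with `0 ≤ t < τ x` of a point of the suspension space. -/
def lift (hτ : IsBoundedAwayFromZero τ) : Suspension τ → Shift B × ℝ :=
  Quot.lift (fun p : Strip τ => if p.1.2 < τ p.1.1 then p.1 else (shiftMap p.1.1, 0)) (by
    rintro ⟨⟨x, s⟩, hs₀, hs₁⟩ ⟨⟨y, r⟩, hr₀, hr₁⟩ ⟨h₁, h₂, h₃⟩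
    dsimp only at h₁ h₂ h₃ ⊢
    subst h₁ h₂ h₃
    simp [hτ.pos])

theorem lift_mk (hτ : IsBoundedAwayFromZero τ) (x : Shift B) (t : ℝ) (h₀ : 0 ≤ t)
    (h₁ : t ≤ τ x) (h : t < τ x) : lift hτ (Suspension.mk x t h₀ h₁) = (x, t) :=
  if_pos h

theorem lift_mem (hτ : IsBoundedAwayFromZero τ) (y : Suspension τ) :
    0 ≤ (lift hτ y).2 ∧ (lift hτ y).2 < τ (lift hτ y).1 := by
  induction y using Quot.ind with
  | _ p =>
    by_cases h : p.1.2 < τ p.1.1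
    · have : lift hτ (Quot.mk _ p) = p.1 := if_pos h
      rw [this]
      exact ⟨p.2.1, h⟩
    · have : lift hτ (Quot.mk _ p) = (shiftMap p.1.1, 0) := if_neg h
      rw [this]
      exact ⟨le_rfl, hτ.pos _⟩

theorem orbit_lift (hτ : IsBoundedAwayFromZero τ) (y : Suspension τ) :
    orbit hτ (lift hτ y).1 (lift hτ y).2 = y := by
  rw [orbit_eq_mk hτ _ _ (lift_mem hτ y).1 (lift_mem hτ y).2.le]
  induction y using Quot.ind with
  | _ p =>
    by_cases h : p.1.2 < τ p.1.1
    · have : lift hτ (Quot.mk _ p) = p.1 := if_pos h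
      simp only [this]
      rfl
    · have : lift hτ (Quot.mk _ p) = (shiftMap p.1.1, 0) := if_neg h
      simp only [this]
      exact (Quot.sound ⟨le_antisymm p.2.2 (not_lt.1 h), rfl, rfl⟩).symm

theorem lift_orbit (hτ : IsBoundedAwayFromZero τ) (x : Shift B) {u : ℝ} (h₀ : 0 ≤ u)
    (h : u < τ x) : lift hτ (orbit hτ x u) = (x, u) := by
  rw [orbit_eq_mk hτ x u h₀ h.le, lift_mk hτ x u h₀ h.le h]

theorem lift_orbit_fst (hτ : IsBoundedAwayFromZero τ) (x : Shift B) {u : ℝ} (h₀ : 0 ≤ u) :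
    (lift hτ (orbit hτ x u)).1 = shiftMap^[returns hτ x u] x := by
  have h1 := birkhoffSum_returns_le hτ x u h₀
  have h2 := lt_birkhoffSum_returns hτ x u
  rw [birkhoffSum_succ] at h2
  have h3 := orbit_birkhoffSum_add hτ (returns hτ x u) x (sub_nonneg.2 h1)
  rw [add_sub_cancel] at h3
  rw [h3, lift_orbit hτ _ (sub_nonneg.2 h1) (by linarith)]

theorem flow_eq_orbit (hτ : IsBoundedAwayFromZero τ) (t : ℝ≥0) (y : Suspension τ) :
    flow hτ t y = orbit hτ (lift hτ y).1 ((lift hτ y).2 + t) := by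
  rw [← flow_orbit hτ t _ (lift_mem hτ y).1, orbit_lift]

/-- The lift jumps only across the base, where heights near the roof drop to `0`; away from height
`0` it behaves like a chart. -/
theorem isOpen_lift_interior (hτ : IsBoundedAwayFromZero τ) (hc : Continuous τ)
    {V : Set (Shift B × ℝ)} (hV : IsOpen V) :
    IsOpen {y : Suspension τ | 0 < (lift hτ y).2 ∧ lift hτ y ∈ V} := by
  change IsOpen (Quot.mk (roofRel τ) ⁻¹'
    {y : Suspension τ | 0 < (lift hτ y).2 ∧ lift hτ y ∈ V})
  have : Quot.mk (roofRel τ) ⁻¹' {y : Suspension τ | 0 < (lift hτ y).2 ∧ lift hτ y ∈ V} =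
      {p : Strip τ | 0 < p.1.2 ∧ p.1.2 < τ p.1.1 ∧ p.1 ∈ V} := by
    ext p
    change (0 < (lift hτ (Quot.mk _ p)).2 ∧ lift hτ (Quot.mk _ p) ∈ V) ↔ _
    by_cases h : p.1.2 < τ p.1.1
    · have : lift hτ (Quot.mk _ p) = p.1 := if_pos h
      simp [this, h]
    · have : lift hτ (Quot.mk _ p) = (shiftMap p.1.1, 0) := if_neg h
      simp [this, h]
  rw [this]
  have c2 : Continuous fun p : Strip τ => p.1.2 := continuous_snd.comp continuous_subtype_val
  have c1 : Continuous fun p : Strip τ => τ p.1.1 :=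
    hc.comp (continuous_fst.comp continuous_subtype_val)
  exact (isOpen_lt continuous_const c2).inter
    ((isOpen_lt c2 c1).inter (hV.preimage continuous_subtype_val))

/-- The part of a preimage above the base is open. Base points are moved to height `c / 2`, still
inside their own fiber, by a continuous time of the flow, which reduces them to the open case. -/
theorem measurable_lift (hτ : IsBoundedAwayFromZero τ) (hc : Continuous τ) :
    Measurable (lift hτ) := by
  obtain ⟨c, hc0, hcτ⟩ := id hτ
  refine measurable_of_isOpen fun V hV => ?_
  let t : ℝ≥0 := ⟨c / 2, by positivity⟩
  have ht : (t : ℝ) = c / 2 := rfl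
  have hW : IsOpen {p : Shift B × ℝ | (p.1, (0 : ℝ)) ∈ V} :=
    hV.preimage (continuous_fst.prodMk continuous_const)
  have : lift hτ ⁻¹' V = {y | 0 < (lift hτ y).2 ∧ lift hτ y ∈ V} ∪
      ({y | 0 < (lift hτ y).2 ∧ lift hτ y ∈ Set.univ}ᶜ ∩ flow hτ t ⁻¹'
        {y | 0 < (lift hτ y).2 ∧ lift hτ y ∈ {p : Shift B × ℝ | (p.1, (0 : ℝ)) ∈ V}}) := by
    ext y
    by_cases h : 0 < (lift hτ y).2
    · simp [h]
    · have h0 : (lift hτ y).2 = 0 := le_antisymm (not_lt.1 h) (lift_mem hτ y).1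
      have h1 : lift hτ y = ((lift hτ y).1, 0) := Prod.ext rfl h0
      have h2 : lift hτ (flow hτ t y) = ((lift hτ y).1, c / 2) := by
        rw [flow_eq_orbit, h0, zero_add, ht, lift_orbit hτ _ (by positivity)]
        linarith [hcτ (lift hτ y).1]
      have h3 : lift hτ y ∈ V ↔ ((lift hτ y).1, (0 : ℝ)) ∈ V := by rw [← h1]
      simp [h, h2, hc0, h3]
  rw [this]
  exact (isOpen_lift_interior hτ hc hV).measurableSet.union
    ((isOpen_lift_interior hτ hc isOpen_univ).measurableSet.compl.inter
      ((isOpen_lift_interior hτ hc hW).preimage (continuous_flow hτ hc t)).measurableSet)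

theorem measurable_flow (hτ : IsBoundedAwayFromZero τ) (hc : Continuous τ) :
    Measurable fun p : Suspension τ × ℝ≥0 => flow hτ p.2 p.1 := by
  simp_rw [flow_eq_orbit]
  have := measurable_lift hτ hc
  refine (continuous_orbit hτ hc).measurable.comp (Measurable.prodMk ?_ ?_)
  · fun_prop
  · fun_prop

end

section

variable {B : Matrix ℕ ℕ ℕ} {τ : Shift B → ℝ} {E : Type*} [NormedAddCommGroup E]

/-! ### Integrals along orbits -/

theorem intervalIntegrable_orbit [MeasurableSpace E] [BorelSpace E] [SecondCountableTopology E]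
    (hτ : IsBoundedAwayFromZero τ) (hc : Continuous τ) {h : Suspension τ → E} (hm : Measurable h)
    {C : ℝ} (hC : ∀ y, ‖h y‖ ≤ C) (x : Shift B) (a b : ℝ) :
    IntervalIntegrable (fun u => h (orbit hτ x u)) volume a b := by
  have : Measurable fun u => h (orbit hτ x u) :=
    hm.comp ((continuous_orbit hτ hc).comp (Continuous.prodMk_right x)).measurable
  exact (intervalIntegrable_const (c := C)).mono_fun' this.aestronglyMeasurable
    (Eventually.of_forall fun u => hC _)

/-- The integral of a function over the fiber above a point of the base. -/
def fiberIntegral [NormedSpace ℝ E] (hτ : IsBoundedAwayFromZero τ) (h : Suspension τ → E)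
    (x : Shift B) : E :=
  ∫ u in (0 : ℝ)..τ x, h (orbit hτ x u)

theorem continuous_fiberIntegral [NormedSpace ℝ E] (hτ : IsBoundedAwayFromZero τ)
    (hc : Continuous τ)
    {h : Suspension τ → E} (hh : Continuous h) : Continuous (fiberIntegral hτ h) :=
  intervalIntegral.continuous_parametric_intervalIntegral_of_continuous
    (f := fun x u => h (orbit hτ x u)) (hh.comp (continuous_orbit hτ hc)) hc

theorem norm_fiberIntegral_le [NormedSpace ℝ E] (hτ : IsBoundedAwayFromZero τ)
    {h : Suspension τ → E} {C : ℝ}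
    (hC : ∀ y, ‖h y‖ ≤ C) (x : Shift B) : ‖fiberIntegral hτ h x‖ ≤ C * τ x := by
  refine (intervalIntegral.norm_integral_le_of_norm_le_const fun u _ => hC _).trans_eq ?_
  rw [sub_zero, abs_of_pos (hτ.pos x)]

theorem birkhoffSum_fiberIntegral [NormedSpace ℝ E] [MeasurableSpace E] [BorelSpace E]
    [SecondCountableTopology E]
    (hτ : IsBoundedAwayFromZero τ) (hc : Continuous τ) {h : Suspension τ → E} (hm : Measurable h)
    {C : ℝ} (hC : ∀ y, ‖h y‖ ≤ C) (n : ℕ) (x : Shift B) :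
    birkhoffSum shiftMap (fiberIntegral hτ h) n x =
      ∫ u in (0 : ℝ)..birkhoffSum shiftMap τ n x, h (orbit hτ x u) := by
  have key := intervalIntegral.sum_integral_adjacent_intervals
    (a := fun k => birkhoffSum shiftMap τ k x) (n := n)
    (fun k _ => intervalIntegrable_orbit hτ hc hm hC x _ _)
  rw [birkhoffSum_zero] at key
  rw [← key]
  refine Finset.sum_congr rfl fun k _ => ?_
  unfold fiberIntegral
  rw [birkhoffSum_succ]
  have h1 := intervalIntegral.integral_comp_add_left (a := 0) (b := τ (shiftMap^[k] x))
    (fun u => h (orbit hτ x u)) (birkhoffSum shiftMap τ k x)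
  rw [add_zero] at h1
  rw [← h1]
  refine intervalIntegral.integral_congr_Ioo_of_le (hτ.pos _).le fun u hu => ?_
  simp only [orbit_birkhoffSum_add hτ k x hu.1.le]

theorem integral_flow_eq [NormedSpace ℝ E] (hτ : IsBoundedAwayFromZero τ) (h : Suspension τ → E)
    {T : ℝ}
    (hT : 0 ≤ T) (y : Suspension τ) :
    ∫ t in (0 : ℝ)..T, h (flow hτ t.toNNReal y) =
      ∫ u in (lift hτ y).2..(lift hτ y).2 + T, h (orbit hτ (lift hτ y).1 u) := by
  have h1 := intervalIntegral.integral_comp_add_left (a := 0) (b := T)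
    (fun u => h (orbit hτ (lift hτ y).1 u)) (lift hτ y).2
  rw [add_zero] at h1
  rw [← h1]
  refine intervalIntegral.integral_congr_Ioo_of_le hT fun u hu => ?_
  simp only [flow_eq_orbit, Real.coe_toNNReal u hu.1.le]

/-- The number of returns to the base of the orbit of `y` within time `T`. -/
def returnsOf (hτ : IsBoundedAwayFromZero τ) (T : ℝ) (y : Suspension τ) : ℕ :=
  returns hτ (lift hτ y).1 ((lift hτ y).2 + T)

theorem lift_flow_fst (hτ : IsBoundedAwayFromZero τ) {T : ℝ} (hT : 0 ≤ T) (y : Suspension τ) :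
    (lift hτ (flow hτ T.toNNReal y)).1 = shiftMap^[returnsOf hτ T y] (lift hτ y).1 := by
  rw [flow_eq_orbit, Real.coe_toNNReal T hT,
    lift_orbit_fst hτ _ (add_nonneg (lift_mem hτ y).1 hT)]
  rfl

/-- The `returnsOf hτ T y + 1` complete fibers exceed the flow segment only by a piece below its
start and a piece above its end, each no longer than its own fiber. -/
theorem norm_birkhoffSum_fiberIntegral_sub_le [NormedSpace ℝ E] [MeasurableSpace E] [BorelSpace E]
    [SecondCountableTopology E]
    (hτ : IsBoundedAwayFromZero τ) (hc : Continuous τ) {h : Suspension τ → E} (hm : Measurable h)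
    {C : ℝ} (hC : ∀ y, ‖h y‖ ≤ C) {T : ℝ} (hT : 0 ≤ T) (y : Suspension τ) :
    ‖birkhoffSum shiftMap (fiberIntegral hτ h) (returnsOf hτ T y + 1) (lift hτ y).1 -
      ∫ t in (0 : ℝ)..T, h (flow hτ t.toNNReal y)‖ ≤
      C * (τ (lift hτ y).1 + τ (lift hτ (flow hτ T.toNNReal y)).1) := by
  rw [birkhoffSum_fiberIntegral hτ hc hm hC, integral_flow_eq hτ h hT, lift_flow_fst hτ hT]
  set x := (lift hτ y).1
  set s := (lift hτ y).2
  set n := returnsOf hτ T y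
  obtain ⟨hs0, hs1⟩ := lift_mem hτ y
  have hsT : 0 ≤ s + T := add_nonneg hs0 hT
  have h1 : birkhoffSum shiftMap τ n x ≤ s + T := birkhoffSum_returns_le hτ x _ hsT
  have h2 : s + T < birkhoffSum shiftMap τ (n + 1) x := lt_birkhoffSum_returns hτ x _
  have h3 : birkhoffSum shiftMap τ (n + 1) x =
    birkhoffSum shiftMap τ n x + τ (shiftMap^[n] x) := birkhoffSum_succ _ _ _ _
  have hi := intervalIntegrable_orbit hτ hc hm hC x
  rw [← intervalIntegral.integral_add_adjacent_intervals (hi 0 s) (hi s _),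
    ← intervalIntegral.integral_add_adjacent_intervals (hi s (s + T)) (hi (s + T) _)]
  have hC0 : 0 ≤ C := (norm_nonneg _).trans (hC y)
  have e1 : ‖∫ u in (0 : ℝ)..s, h (orbit hτ x u)‖ ≤ C * |s - 0| :=
    intervalIntegral.norm_integral_le_of_norm_le_const fun u _ => hC _
  have e2 : ‖∫ u in (s + T)..birkhoffSum shiftMap τ (n + 1) x, h (orbit hτ x u)‖ ≤
      C * |birkhoffSum shiftMap τ (n + 1) x - (s + T)| :=
    intervalIntegral.norm_integral_le_of_norm_le_const fun u _ => hC _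
  rw [sub_zero, abs_of_nonneg hs0] at e1
  rw [abs_of_nonneg (by linarith)] at e2
  have e3 : C * s ≤ C * τ x := mul_le_mul_of_nonneg_left hs1.le hC0
  have e4 : C * (birkhoffSum shiftMap τ (n + 1) x - (s + T)) ≤ C * τ (shiftMap^[n] x) :=
    mul_le_mul_of_nonneg_left (by linarith) hC0
  have e5 : ∀ a b c : E, a + (b + c) - b = a + c := fun a b c => by abel
  rw [e5, mul_add]
  exact (norm_add_le _ _).trans (by linarith)

/-! ### Oscillation on cylinders -/

/-- The oscillation at `x` of `F` on the cylinder of length `L` around `x`. -/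
def osc (F : Shift B → E) (L : ℕ) (x : Shift B) : ℝ :=
  ⨆ y : {y : Shift B // ∀ i < L, y.1 i = x.1 i}, ‖F y - F x‖

theorem exists_variation_bound (hv : variation 2 τ < ∞) :
    ∃ V : ℝ, 0 ≤ V ∧ ∀ x y : Shift B, (∀ i < 2, x.1 i = y.1 i) → τ x ≤ τ y + V := by
  refine ⟨(variation 2 τ).toReal, ENNReal.toReal_nonneg, fun x y h => ?_⟩
  have h1 : ENNReal.ofReal |τ x - τ y| ≤ variation 2 τ :=
    le_iSup_of_le x (le_iSup_of_le y (le_iSup_of_le ((Shift.dist_le_iff x y 2).2 h) le_rfl))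
  have h2 := (ENNReal.ofReal_le_iff_le_toReal hv.ne).1 h1
  linarith [le_abs_self (τ x - τ y)]

section Osc

variable {F : Shift B → E} {C V : ℝ} (hF : ∀ x, ‖F x‖ ≤ C * τ x) (hC : 0 ≤ C)
  (hV : ∀ x y : Shift B, (∀ i < 2, x.1 i = y.1 i) → τ x ≤ τ y + V) {L : ℕ} (hL : 2 ≤ L)

include hF hC hV hL

theorem norm_sub_le_of_agree (x y : Shift B) (h : ∀ i < L, y.1 i = x.1 i) :
    ‖F y - F x‖ ≤ C * (2 * τ x + V) := by
  have h1 := hV y x fun i hi => h i (by omega)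
  have h2 := mul_le_mul_of_nonneg_left h1 hC
  linarith [norm_sub_le (F y) (F x), hF x, hF y]

/-- Without this bound the real supremum in `osc` could be the default value `0`. It is where `2 ≤
L` and the second variation enter. -/
theorem bddAbove_osc (x : Shift B) :
    BddAbove (Set.range fun y : {y : Shift B // ∀ i < L, y.1 i = x.1 i} => ‖F y - F x‖) :=
  ⟨C * (2 * τ x + V), by
    rintro _ ⟨y, rfl⟩
    exact norm_sub_le_of_agree hF hC hV hL x y y.2⟩

theorem norm_sub_le_osc (x y : Shift B) (h : ∀ i < L, y.1 i = x.1 i) :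
    ‖F y - F x‖ ≤ osc F L x :=
  le_ciSup (bddAbove_osc hF hC hV hL x) ⟨y, h⟩

theorem osc_le (x : Shift B) : osc F L x ≤ C * (2 * τ x + V) :=
  have : Nonempty {y : Shift B // ∀ i < L, y.1 i = x.1 i} := ⟨⟨x, fun _ _ => rfl⟩⟩
  ciSup_le fun y => norm_sub_le_of_agree hF hC hV hL x y y.2

/-- The oscillation is lower semicontinuous: a witness `y` at `x` also serves all `z` close to `x`,
which lie in the same cylinder. -/
theorem measurable_osc (hc : Continuous F) : Measurable (osc F L) := by
  refine measurable_of_Ioi fun a => IsOpen.measurableSet (isOpen_iff_mem_nhds.2 fun x hx => ?_)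
  have : Nonempty {y : Shift B // ∀ i < L, y.1 i = x.1 i} := ⟨⟨x, fun _ _ => rfl⟩⟩
  obtain ⟨⟨y, hy⟩, hxy⟩ := exists_lt_of_lt_ciSup (show a < osc F L x from hx)
  have h1 : ∀ᶠ z in 𝓝 x, a < ‖F y - F z‖ :=
    (continuous_const.sub hc).norm.continuousAt.eventually (lt_mem_nhds hxy)
  filter_upwards [h1, (Shift.isOpen_agree x L).mem_nhds (fun _ _ => rfl)] with z hz hz'
  exact hz.trans_le (norm_sub_le_osc hF hC hV hL z y fun i hi => (hy i hi).trans (hz' i hi).symm)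

end Osc

theorem osc_nonneg (F : Shift B → E) (L : ℕ) (x : Shift B) : 0 ≤ osc F L x :=
  Real.iSup_nonneg fun _ => norm_nonneg _

theorem tendsto_osc {F : Shift B → E} (hc : Continuous F) (x : Shift B) :
    Tendsto (fun L => osc F L x) atTop (𝓝 0) := by
  refine Metric.tendsto_atTop.2 fun ε hε => ?_
  obtain ⟨δ, hδ, h⟩ := Metric.continuousAt_iff.1 hc.continuousAt (ε / 2) (half_pos hε)
  obtain ⟨N, hN⟩ := exists_pow_lt_of_lt_one hδ (by norm_num : (1 / 2 : ℝ) < 1)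
  refine ⟨N, fun L hL => ?_⟩
  rw [Real.dist_0_eq_abs, abs_of_nonneg (osc_nonneg F L x)]
  refine lt_of_le_of_lt (Real.iSup_le (fun y => ?_) (half_pos hε).le) (half_lt_self hε)
  rw [← dist_eq_norm]
  exact (h (lt_of_le_of_lt ((Shift.dist_le_iff _ _ N).2 fun i hi => y.2 i (hi.trans_le hL)) hN)).le

/-- The function on the suspension space, constant on fibers, whose integral over the fiber
above `x` is the oscillation of `F` at `x`. -/
def oscDensity (hτ : IsBoundedAwayFromZero τ) (F : Shift B → E) (L : ℕ) (y : Suspension τ) : ℝ :=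
  osc F L (lift hτ y).1 / τ (lift hτ y).1

theorem oscDensity_nonneg (hτ : IsBoundedAwayFromZero τ) (F : Shift B → E) (L : ℕ)
    (y : Suspension τ) : 0 ≤ oscDensity hτ F L y :=
  div_nonneg (osc_nonneg _ _ _) (hτ.pos _).le

theorem fiberIntegral_oscDensity (hτ : IsBoundedAwayFromZero τ) (F : Shift B → E) (L : ℕ) :
    fiberIntegral hτ (oscDensity hτ F L) = osc F L := by
  funext x
  unfold fiberIntegral
  rw [intervalIntegral.integral_congr_Ioo_of_le (g := fun _ => osc F L x / τ x) (hτ.pos x).le]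
  · rw [intervalIntegral.integral_const, sub_zero, smul_eq_mul, mul_div_cancel₀ _ (hτ.pos x).ne']
  · intro u hu
    simp only [oscDensity, lift_orbit hτ x hu.1.le hu.2]

/-! ### Paths -/

/-- There is a path of length `n` from `a` to `b` such that the sum of `F` along any orbit that
follows this path is at distance at most `e` from `I`. -/
def PathApprox (F : Shift B → E) (a b n : ℕ) (I : E) (e : ℝ) : Prop :=
  ∃ v : ℕ → ℕ, v 0 = a ∧ v n = b ∧ (∀ i < n, B (v i) (v (i + 1)) = 1) ∧
    ∀ q : Shift B, (∀ i ≤ n, q.1 i = v i) → ‖birkhoffSum shiftMap F n q - I‖ ≤ e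

/-- The estimate in `PathApprox` covers every point following the word, so it applies to `q` for the
first word and to its `n`-th shift for the second. -/
theorem PathApprox.trans {F : Shift B → E} {a b c n m : ℕ} {I J : E} {d e : ℝ}
    (h₁ : PathApprox F a b n I d) (h₂ : PathApprox F b c m J e) :
    PathApprox F a c (n + m) (I + J) (d + e) := by
  obtain ⟨v, v0, vn, vB, hv⟩ := h₁
  obtain ⟨w, w0, wm, wB, hw⟩ := h₂
  have hr : ∀ i, (fun i => if i ≤ n then v i else w (i - n)) (n + i) = w i := by
    intro i
    rcases i with _ | i
    · simp [vn, w0]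
    · simp
  refine ⟨fun i => if i ≤ n then v i else w (i - n), by simpa using v0, (hr m).trans wm, ?_, ?_⟩
  · intro i hi
    rcases lt_or_ge i n with h | h
    · simp only [if_pos h.le, if_pos (Nat.succ_le_of_lt h)]
      exact vB i h
    · obtain ⟨j, rfl⟩ := Nat.exists_eq_add_of_le h
      rw [hr j, add_assoc n j 1, hr (j + 1)]
      exact wB j (by omega)
  · intro q hq
    rw [birkhoffSum_add, add_sub_add_comm]
    refine (norm_add_le _ _).trans (add_le_add (hv q fun i hi => ?_) (hw _ fun i hi => ?_))
    · exact (hq i (by omega)).trans (if_pos hi)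
    · rw [shiftMap_iterate_coord, hq (n + i) (by omega)]
      exact hr i

theorem PathApprox.mono {F : Shift B → E} {a b n : ℕ} {I : E} {d e : ℝ}
    (h : PathApprox F a b n I d) (hde : d ≤ e) : PathApprox F a b n I e := by
  obtain ⟨v, v0, vn, vB, hv⟩ := h
  exact ⟨v, v0, vn, vB, fun q hq => (hv q hq).trans hde⟩

theorem PathApprox.exists_periodic {F : Shift B → E} {a n : ℕ} {I : E} {e : ℝ}
    (h : PathApprox F a a n I e) (hn : 0 < n) :
    ∃ p : Shift B, shiftMap^[n] p = p ∧ ‖birkhoffSum shiftMap F n p - I‖ ≤ e := by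
  obtain ⟨v, v0, vn, vB, hv⟩ := h
  -- The case `i = n` is where the path being a loop is used.
  have hmod : ∀ i ≤ n, v (i % n) = v i := by
    intro i hi
    rcases hi.lt_or_eq with h | rfl
    · rw [Nat.mod_eq_of_lt h]
    · rw [Nat.mod_self, v0, vn]
  let p : Shift B := ⟨fun k => v (k % n), fun k => by
    have h1 := Nat.mod_lt k hn
    have h2 : v ((k + 1) % n) = v (k % n + 1) := by
      rw [← hmod (k % n + 1) h1, Nat.mod_add_mod]
    change B (v (k % n)) (v ((k + 1) % n)) = 1
    rw [h2]
    exact vB _ h1⟩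
  refine ⟨p, Subtype.ext (funext fun i => ?_), hv p fun i hi => hmod i hi⟩
  rw [shiftMap_iterate_coord]
  change v ((n + i) % n) = v (i % n)
  rw [Nat.add_mod_left]

theorem exists_shift_coord_zero (hB : IsTransitionMatrix B) (a : ℕ) :
    ∃ x : Shift B, x.1 0 = a := by
  choose f hf using hB.row
  exact ⟨⟨fun n => f^[n] a, fun n => by
    change B (f^[n] a) (f^[n + 1] a) = 1
    rw [Function.iterate_succ_apply']
    exact hf _⟩, rfl⟩

/-- Agreement at the indices `0, …, n` leaves two common letters after each of the first `n` shifts,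
which is what `hV` requires. -/
theorem norm_birkhoffSum_le {F : Shift B → E} {C V : ℝ} (hF : ∀ x, ‖F x‖ ≤ C * τ x)
    (hC : 0 ≤ C) (hV : ∀ x y : Shift B, (∀ i < 2, x.1 i = y.1 i) → τ x ≤ τ y + V) {n : ℕ}
    {x q : Shift B} (h : ∀ i ≤ n, q.1 i = x.1 i) :
    ‖birkhoffSum shiftMap F n q‖ ≤ C * (birkhoffSum shiftMap τ n x + n * V) := by
  have h1 : ∀ i ∈ Finset.range n,
      ‖F (shiftMap^[i] q)‖ ≤ C * (τ (shiftMap^[i] x) + V) := by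
    intro i hi
    refine (hF _).trans (mul_le_mul_of_nonneg_left (hV _ _ fun j hj => ?_) hC)
    rw [shiftMap_iterate_coord, shiftMap_iterate_coord]
    exact h _ (by have := Finset.mem_range.1 hi; omega)
  refine (norm_sum_le_of_le _ h1).trans_eq ?_
  rw [← Finset.mul_sum, Finset.sum_add_distrib]
  simp [birkhoffSum]

theorem exists_pathApprox (hB : IsTransitionMatrix B) (hB' : IsTransitive B) {F : Shift B → E}
    {C V : ℝ} (hF : ∀ x, ‖F x‖ ≤ C * τ x) (hC : 0 ≤ C)
    (hV : ∀ x y : Shift B, (∀ i < 2, x.1 i = y.1 i) → τ x ≤ τ y + V) (a b : ℕ) :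
    ∃ (n : ℕ) (d : ℝ), PathApprox F a b n 0 d := by
  have ho : ∀ a, IsOpen {x : Shift B | x.1 0 = a} := fun a =>
    (isOpen_discrete {a}).preimage (Shift.continuous_coord 0)
  obtain ⟨n, x, hx, hx'⟩ := hB' _ _ (ho a) (exists_shift_coord_zero hB a) (ho b)
    (exists_shift_coord_zero hB b)
  refine ⟨n, C * (birkhoffSum shiftMap τ n x + n * V), x.1, hx, ?_, fun i _ => x.2 i, ?_⟩
  · have h : (shiftMap^[n] x).1 0 = b := hx'
    rwa [shiftMap_iterate_coord] at h
  · intro q hq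
    rw [sub_zero]
    exact norm_birkhoffSum_le hF hC hV hq

end

section

variable {B : Matrix ℕ ℕ ℕ} {τ : Shift B → ℝ} {E : Type*} [NormedAddCommGroup E]

/-! ### Orbit segments are shadowed by loops -/

theorem measurable_oscDensity (hτ : IsBoundedAwayFromZero τ) (hc : Continuous τ)
    {F : Shift B → E} {L : ℕ} (hm : Measurable (osc F L)) : Measurable (oscDensity hτ F L) :=
  (hm.comp (measurable_lift hτ hc).fst).div (hc.measurable.comp (measurable_lift hτ hc).fst)

/-- The bound does not depend on `L`, so it serves as the dominating constant when `L → ∞`. -/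
theorem norm_oscDensity_le (hτ : IsBoundedAwayFromZero τ) {F : Shift B → E} {C V : ℝ}
    (hF : ∀ x, ‖F x‖ ≤ C * τ x) (hC : 0 ≤ C) (hV0 : 0 ≤ V)
    (hV : ∀ x y : Shift B, (∀ i < 2, x.1 i = y.1 i) → τ x ≤ τ y + V) {L : ℕ} (hL : 2 ≤ L)
    {c : ℝ} (hc0 : 0 < c) (hcτ : ∀ x, c ≤ τ x) (y : Suspension τ) :
    ‖oscDensity hτ F L y‖ ≤ C * (2 + V / c) := by
  rw [Real.norm_of_nonneg (oscDensity_nonneg hτ F L y)]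
  set x := (lift hτ y).1
  have h1 : V / τ x ≤ V / c := div_le_div_of_nonneg_left hV0 hc0 (hcτ x)
  calc osc F L x / τ x ≤ C * (2 * τ x + V) / τ x :=
        div_le_div_of_nonneg_right (osc_le hF hC hV hL x) (hτ.pos x).le
    _ = C * (2 + V / τ x) := by
        have := (hτ.pos x).ne'
        field_simp
    _ ≤ C * (2 + V / c) := mul_le_mul_of_nonneg_left (by linarith) hC

/-- The word runs `l` steps beyond the `n + 1` fibers met by the segment, so that `q` and `x` still
share `l + 1` letters after each of the first `n` shifts. The error on those fibers is then a
Birkhoff sum of `osc`, which is a flow integral of `oscDensity` up to boundary terms; the extra `l`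
steps are bounded crudely. -/
theorem pathApprox_segment [NormedSpace ℝ E] [MeasurableSpace E] [BorelSpace E]
    [SecondCountableTopology E]
    (hτ : IsBoundedAwayFromZero τ) (hc : Continuous τ) {f : Suspension τ → E} (hf : Continuous f)
    {C V D : ℝ} (hC : ∀ y, ‖f y‖ ≤ C)
    (hV : ∀ x y : Shift B, (∀ i < 2, x.1 i = y.1 i) → τ x ≤ τ y + V) {l : ℕ} (hl : 1 ≤ l)
    (hD : ∀ y, ‖oscDensity hτ (fiberIntegral hτ f) (l + 1) y‖ ≤ D) {T : ℝ} (hT : 0 ≤ T)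
    (y : Suspension τ) :
    PathApprox (fiberIntegral hτ f) ((lift hτ y).1.1 0)
      ((lift hτ (flow hτ T.toNNReal y)).1.1 (l + 1)) (returnsOf hτ T y + (l + 1))
      (∫ t in (0 : ℝ)..T, f (flow hτ t.toNNReal y))
      ((∫ t in (0 : ℝ)..T,
          oscDensity hτ (fiberIntegral hτ f) (l + 1) (flow hτ t.toNNReal y)) +
        (C + D) * (τ (lift hτ y).1 + τ (lift hτ (flow hτ T.toNNReal y)).1) +
        C * (birkhoffSum shiftMap τ l (shiftMap (lift hτ (flow hτ T.toNNReal y)).1) +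
          l * V)) := by
  have hC0 : 0 ≤ C := (norm_nonneg _).trans (hC y)
  have hF := norm_fiberIntegral_le hτ hC
  have hL : 2 ≤ l + 1 := by omega
  have e1 := norm_birkhoffSum_fiberIntegral_sub_le hτ hc hf.measurable hC hT y
  have e2 := norm_birkhoffSum_fiberIntegral_sub_le hτ hc (measurable_oscDensity hτ hc
    (measurable_osc hF hC0 hV hL (continuous_fiberIntegral hτ hc hf))) hD hT y
  rw [fiberIntegral_oscDensity] at e2
  rw [lift_flow_fst hτ hT] at e1 e2 ⊢
  set x := (lift hτ y).1
  set n := returnsOf hτ T y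
  set F := fiberIntegral hτ f
  refine ⟨x.1, rfl, (shiftMap_iterate_coord n (l + 1) x).symm, fun i _ => x.2 i, fun q hq => ?_⟩
  have e3 : ‖birkhoffSum shiftMap F (n + 1) q - birkhoffSum shiftMap F (n + 1) x‖ ≤
      birkhoffSum shiftMap (osc F (l + 1)) (n + 1) x := by
    unfold birkhoffSum
    rw [← Finset.sum_sub_distrib]
    refine norm_sum_le_of_le _ fun i hi => norm_sub_le_osc hF hC0 hV hL _ _ fun j hj => ?_
    rw [shiftMap_iterate_coord, shiftMap_iterate_coord]
    exact hq _ (by have := Finset.mem_range.1 hi; omega)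
  have e4 : ‖birkhoffSum shiftMap F l (shiftMap^[n + 1] q)‖ ≤
      C * (birkhoffSum shiftMap τ l (shiftMap^[n + 1] x) + l * V) := by
    refine norm_birkhoffSum_le hF hC0 hV fun i hi => ?_
    rw [shiftMap_iterate_coord, shiftMap_iterate_coord]
    exact hq _ (by omega)
  rw [Function.iterate_succ_apply' shiftMap n x] at e4
  have e5 : n + (l + 1) = n + 1 + l := by omega
  rw [e5, birkhoffSum_add, add_sub_right_comm]
  refine (norm_add_le _ _).trans ?_
  have e6 := norm_sub_le_norm_sub_add_norm_sub (birkhoffSum shiftMap F (n + 1) q)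
    (birkhoffSum shiftMap F (n + 1) x) (∫ t in (0 : ℝ)..T, f (flow hτ t.toNNReal y))
  have e7 := (le_abs_self _).trans ((Real.norm_eq_abs _).symm.le.trans e2)
  linarith

/-- The segment is joined to the symbol `0` at both ends. The point is that `κ₁` and `κ₂` do not
depend on `T`; they may be unbounded, and only their measurability is needed. -/
theorem exists_loopApprox [NormedSpace ℝ E] [MeasurableSpace E] [BorelSpace E]
    [SecondCountableTopology E]
    (hB : IsTransitionMatrix B) (hB' : IsTransitive B)
    (hτ : IsBoundedAwayFromZero τ) (hc : Continuous τ) {f : Suspension τ → E} (hf : Continuous f)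
    {C V D : ℝ} (hC0 : 0 ≤ C) (hC : ∀ y, ‖f y‖ ≤ C)
    (hV : ∀ x y : Shift B, (∀ i < 2, x.1 i = y.1 i) → τ x ≤ τ y + V) {L : ℕ} (hL : 2 ≤ L)
    (hD : ∀ y, ‖oscDensity hτ (fiberIntegral hτ f) L y‖ ≤ D) :
    ∃ κ₁ κ₂ : Shift B → ℝ, Measurable κ₁ ∧ Measurable κ₂ ∧
      ∀ (y : Suspension τ) (T : ℝ), 0 ≤ T → ∃ n, 0 < n ∧
        PathApprox (fiberIntegral hτ f) 0 0 n (∫ t in (0 : ℝ)..T, f (flow hτ t.toNNReal y))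
          ((∫ t in (0 : ℝ)..T,
              oscDensity hτ (fiberIntegral hτ f) L (flow hτ t.toNNReal y)) +
            (κ₁ (lift hτ y).1 + κ₂ (lift hτ (flow hτ T.toNNReal y)).1)) := by
  obtain ⟨l, rfl⟩ : ∃ l, L = l + 1 := ⟨L - 1, by omega⟩
  choose m d hd using fun a b =>
    exists_pathApprox hB hB' (norm_fiberIntegral_le hτ hC) hC0 hV a b
  have hcoord : ∀ i, Measurable fun x : Shift B => x.1 i := fun i =>
    (Shift.continuous_coord i).measurable
  refine ⟨fun x => d 0 (x.1 0) + (C + D) * τ x,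
    fun z => d (z.1 (l + 1)) 0 + (C + D) * τ z +
      C * (birkhoffSum shiftMap τ l (shiftMap z) + l * V), ?_, ?_, ?_⟩
  · exact ((measurable_from_nat (f := d 0)).comp (hcoord 0)).add (hc.measurable.const_mul _)
  · refine (((measurable_from_nat (f := fun a => d a 0)).comp (hcoord _)).add
      (hc.measurable.const_mul _)).add (((Measurable.add_const ?_ _)).const_mul _)
    exact ((continuous_birkhoffSum hc l).comp continuous_shiftMap).measurable
  · intro y T hT
    have h := ((hd 0 _).trans (pathApprox_segment hτ hc hf hC hV (by omega) hD hT y)).trans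
      (hd _ 0)
    rw [zero_add, add_zero] at h
    exact ⟨_, by omega, h.mono (by linarith)⟩

theorem exists_pathApprox_sum {F : Shift B → E} {a : ℕ} {ι : Type*} {s : Finset ι}
    (hs : s.Nonempty) (I : ι → E) (e : ι → ℝ)
    (h : ∀ i ∈ s, ∃ n, 0 < n ∧ PathApprox F a a n (I i) (e i)) :
    ∃ n, 0 < n ∧ PathApprox F a a n (∑ i ∈ s, I i) (∑ i ∈ s, e i) := by
  induction hs using Finset.Nonempty.cons_induction with
  | singleton i => simpa using h i
  | cons i s hi hs ih =>
    obtain ⟨n, hn, h1⟩ := h i (by simp)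
    obtain ⟨k, hk, h2⟩ := ih fun j hj => h j (by simp [hj])
    rw [Finset.sum_cons, Finset.sum_cons]
    exact ⟨n + k, by omega, h1.trans h2⟩

/-! ### Sampling -/

/-- Real weights become multiplicities: take `⌊w i * x⌋₊` copies of `z i` and let `x → ∞`. -/
theorem exists_card_smul_sum_near [NormedSpace ℝ E] {H : Set E} {v : E} (hv : v ∈ convexHull ℝ H)
    {ε : ℝ}
    (hε : 0 < ε) :
    ∃ (ι : Type) (_ : Fintype ι) (_ : Nonempty ι) (z : ι → E), (∀ i, z i ∈ H) ∧
      ‖(Fintype.card ι : ℝ)⁻¹ • ∑ i, z i - v‖ < ε := by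
  obtain ⟨κ, _, w, z, hw0, hw1, hz, rfl⟩ := mem_convexHull_iff_exists_fintype.1 hv
  have h1 : ∀ i, Tendsto (fun x : ℝ => (⌊w i * x⌋₊ : ℝ) / x) atTop (𝓝 (w i)) := fun i =>
    tendsto_nat_floor_mul_div_atTop (hw0 i)
  have h2 : Tendsto (fun x : ℝ => ∑ i, (⌊w i * x⌋₊ : ℝ) / x) atTop (𝓝 1) := by
    rw [← hw1]
    exact tendsto_finsetSum _ fun i _ => h1 i
  have h3 : Tendsto (fun x : ℝ => (∑ i, (⌊w i * x⌋₊ : ℝ) / x)⁻¹ •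
      ∑ i, ((⌊w i * x⌋₊ : ℝ) / x) • z i) atTop (𝓝 (∑ i, w i • z i)) := by
    have := (h2.inv₀ one_ne_zero).smul
      (tendsto_finsetSum Finset.univ fun i _ => (h1 i).smul_const (z i))
    rwa [inv_one, one_smul] at this
  obtain ⟨x, hx1, hx2, hx0⟩ := ((h2.eventually (lt_mem_nhds one_pos)).and
    ((Metric.tendsto_nhds.1 h3 ε hε).and (eventually_gt_atTop 0))).exists
  rw [← Finset.sum_div] at hx1
  have hcard : (Fintype.card (Σ i, Fin ⌊w i * x⌋₊) : ℝ) = ∑ i, (⌊w i * x⌋₊ : ℝ) := by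
    simp
  refine ⟨Σ i, Fin ⌊w i * x⌋₊, inferInstance, ?_, fun j => z j.1, fun j => hz _, ?_⟩
  · rw [← Fintype.card_pos_iff]
    have : (0 : ℝ) < Fintype.card (Σ i, Fin ⌊w i * x⌋₊) := by
      rw [hcard]
      exact (div_pos_iff_of_pos_right hx0).1 hx1
    exact_mod_cast this
  · rw [dist_eq_norm] at hx2
    refine lt_of_eq_of_lt (congrArg (fun u => ‖u - ∑ i, w i • z i‖) ?_) hx2
    rw [hcard, ← Finset.sum_div, inv_div, Fintype.sum_sigma]
    simp only [Finset.sum_const, Finset.card_univ, Fintype.card_fin, div_eq_inv_mul, mul_smul,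
      Nat.cast_smul_eq_nsmul, ← Finset.smul_sum]
    rw [smul_comm x, smul_smul x⁻¹ x, inv_mul_cancel₀ hx0.ne', one_smul]

/-- The average over `G` lies in the closed convex hull of `h '' G`, hence is nearly a uniform
average of finitely many values. Replacing the full integral by the average over `G` costs at most
`2 * C * δ`. -/
theorem exists_sample {Ω : Type*} [MeasurableSpace Ω] (μ : Measure Ω) [IsProbabilityMeasure μ]
    [NormedSpace ℝ E] [CompleteSpace E] {h : Ω → E} (hi : Integrable h μ) {C : ℝ}
    (hC : ∀ ω, ‖h ω‖ ≤ C)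
    {G : Set Ω} (hG : MeasurableSet G) {δ : ℝ} (hδ : μ.real Gᶜ ≤ δ) (hδ1 : δ < 1) {ε : ℝ}
    (hε : 0 < ε) :
    ∃ (ι : Type) (_ : Fintype ι) (_ : Nonempty ι) (y : ι → Ω), (∀ i, y i ∈ G) ∧
      ‖(Fintype.card ι : ℝ)⁻¹ • ∑ i, h (y i) - ∫ ω, h ω ∂μ‖ ≤ 2 * C * δ + ε := by
  have hadd : μ.real G + μ.real Gᶜ = 1 := by
    rw [measureReal_add_measureReal_compl hG]; simp
  have hpos : 0 < μ.real G := by linarith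
  have hC0 : 0 ≤ C := by
    obtain ⟨ω⟩ : Nonempty Ω := μ.nonempty_of_neZero
    exact (norm_nonneg _).trans (hC ω)
  have hmem : (⨍ ω in G, h ω ∂μ) ∈ closure (convexHull ℝ (h '' G)) := by
    refine (convex_convexHull ℝ _).set_average_mem_closure ?_ (measure_ne_top _ _) ?_
      hi.integrableOn
    · intro h0
      simp [Measure.real, h0] at hpos
    · filter_upwards [ae_restrict_mem hG] with ω hω
      exact subset_convexHull ℝ _ ⟨ω, hω, rfl⟩
  obtain ⟨v, hv, hdist⟩ := Metric.mem_closure_iff.1 hmem (ε / 2) (half_pos hε)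
  obtain ⟨ι, hι, hι', z, hz, hzv⟩ := exists_card_smul_sum_near hv (half_pos hε)
  choose y hyG hyz using hz
  refine ⟨ι, hι, hι', y, hyG, ?_⟩
  simp only [hyz]
  have havg : ‖(⨍ ω in G, h ω ∂μ)‖ ≤ C := by
    rw [setAverage_eq, norm_smul, norm_inv, Real.norm_of_nonneg hpos.le, inv_mul_le_iff₀ hpos,
      mul_comm]
    exact norm_setIntegral_le_of_norm_le_const (measure_lt_top _ _) fun ω _ => hC ω
  have hcompl : ‖∫ ω in Gᶜ, h ω ∂μ‖ ≤ C * μ.real Gᶜ :=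
    norm_setIntegral_le_of_norm_le_const (measure_lt_top _ _) fun ω _ => hC ω
  have hsplit : (⨍ ω in G, h ω ∂μ) - ∫ ω, h ω ∂μ =
      μ.real Gᶜ • (⨍ ω in G, h ω ∂μ) - ∫ ω in Gᶜ, h ω ∂μ := by
    have h1 : ∫ ω in G, h ω ∂μ = μ.real G • (⨍ ω in G, h ω ∂μ) := by
      rw [setAverage_eq, smul_smul, mul_inv_cancel₀ hpos.ne', one_smul]
    rw [← integral_add_compl hG hi, h1, ← sub_sub]
    congr 1
    rw [sub_eq_iff_eq_add, ← add_smul, add_comm, hadd, one_smul]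
  have h2 : ‖(⨍ ω in G, h ω ∂μ) - ∫ ω, h ω ∂μ‖ ≤ 2 * C * δ := by
    rw [hsplit]
    refine (norm_sub_le _ _).trans ?_
    rw [norm_smul, Real.norm_of_nonneg measureReal_nonneg]
    have h3 := mul_le_mul_of_nonneg_left havg (measureReal_nonneg (μ := μ) (s := Gᶜ))
    have h4 := mul_le_mul_of_nonneg_left hδ hC0
    linarith
  rw [dist_comm, dist_eq_norm] at hdist
  have h5 := norm_add₃_le (a := (Fintype.card ι : ℝ)⁻¹ • ∑ i, z i - v)
    (b := v - ⨍ ω in G, h ω ∂μ) (c := (⨍ ω in G, h ω ∂μ) - ∫ ω, h ω ∂μ)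
  rw [sub_add_sub_cancel, sub_add_sub_cancel] at h5
  linarith

/-! ### Time averages of invariant measures -/

theorem measurable_flow_toNNReal (hτ : IsBoundedAwayFromZero τ) (hc : Continuous τ) :
    Measurable fun p : Suspension τ × ℝ => flow hτ p.2.toNNReal p.1 :=
  (measurable_flow hτ hc).comp (measurable_fst.prodMk measurable_snd.real_toNNReal)

variable [MeasurableSpace E] [BorelSpace E] [SecondCountableTopology E]

theorem integrable_flow (hτ : IsBoundedAwayFromZero τ) (hc : Continuous τ)
    {h : Suspension τ → E} (hm : Measurable h) {C : ℝ} (hC : ∀ y, ‖h y‖ ≤ C)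
    (ν : Measure (Suspension τ)) [IsProbabilityMeasure ν] (T : ℝ) :
    Integrable (fun p : Suspension τ × ℝ => h (flow hτ p.2.toNNReal p.1))
      (ν.prod (volume.restrict (Set.Ioc 0 T))) :=
  Integrable.of_bound (hm.comp (measurable_flow_toNNReal hτ hc)).aestronglyMeasurable C
    (Eventually.of_forall fun _ => hC _)

theorem integrable_integral_flow [NormedSpace ℝ E]
    (hτ : IsBoundedAwayFromZero τ) (hc : Continuous τ)
    {h : Suspension τ → E} (hm : Measurable h) {C : ℝ} (hC : ∀ y, ‖h y‖ ≤ C)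
    (ν : Measure (Suspension τ)) [IsProbabilityMeasure ν] {T : ℝ} (hT : 0 ≤ T) :
    Integrable (fun y => ∫ t in (0 : ℝ)..T, h (flow hτ t.toNNReal y)) ν := by
  simp_rw [intervalIntegral.integral_of_le hT]
  exact (integrable_flow hτ hc hm hC ν T).integral_prod_left

theorem integral_integral_flow [NormedSpace ℝ E] [CompleteSpace E]
    (hτ : IsBoundedAwayFromZero τ) (hc : Continuous τ)
    {h : Suspension τ → E} (hm : Measurable h) {C : ℝ} (hC : ∀ y, ‖h y‖ ≤ C)
    {ν : ProbabilityMeasure (Suspension τ)} (hν : ν ∈ invariantMeasures hτ) {T : ℝ} (hT : 0 ≤ T) :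
    ∫ y, (∫ t in (0 : ℝ)..T, h (flow hτ t.toNNReal y)) ∂(ν : Measure (Suspension τ)) =
      T • ∫ y, h y ∂(ν : Measure (Suspension τ)) := by
  simp_rw [intervalIntegral.integral_of_le hT]
  have hint : Integrable (Function.uncurry fun (y : Suspension τ) (t : ℝ) =>
      h (flow hτ t.toNNReal y)) ((ν : Measure (Suspension τ)).prod
        (volume.restrict (Set.Ioc 0 T))) := integrable_flow hτ hc hm hC _ T
  rw [integral_integral_swap hint]
  have key : ∀ t : ℝ≥0, ∫ y, h (flow hτ t y) ∂(ν : Measure (Suspension τ)) =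
      ∫ y, h y ∂(ν : Measure (Suspension τ)) := by
    intro t
    have hmt := (continuous_flow hτ hc t).measurable
    have hmap : (ν : Measure (Suspension τ)).map (flow hτ t) = ν :=
      Measure.ext fun A hA => by rw [Measure.map_apply hmt hA, hν t A hA]
    have h1 := integral_map (μ := (ν : Measure (Suspension τ))) (f := h) hmt.aemeasurable
      hm.aestronglyMeasurable
    rw [hmap] at h1
    exact h1.symm
  simp_rw [key]
  rw [integral_const]
  simp [hT]

end

section

variable {B : Matrix ℕ ℕ ℕ} {τ : Shift B → ℝ}

/-! ### Approximation by periodic orbits -/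

theorem exists_measureReal_lt_le {Ω : Type*} [MeasurableSpace Ω] (μ : Measure Ω)
    [IsFiniteMeasure μ] {φ : Ω → ℝ} (hφ : Measurable φ) {δ : ℝ} (hδ : 0 < δ) :
    ∃ H₀ : ℝ, ∀ H, H₀ ≤ H → μ.real {ω | H < φ ω} ≤ δ := by
  have h1 : Tendsto (fun k : ℕ => μ {ω | (k : ℝ) < φ ω}) atTop
      (𝓝 (μ (⋂ k : ℕ, {ω | (k : ℝ) < φ ω}))) := by
    refine tendsto_measure_iInter_atTop
      (fun k => (measurableSet_lt measurable_const hφ).nullMeasurableSet) ?_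
      ⟨0, measure_ne_top _ _⟩
    intro k m hkm ω hω
    have hω' : (m : ℝ) < φ ω := hω
    exact lt_of_le_of_lt (Nat.cast_le.2 hkm) hω'
  have h2 : (⋂ k : ℕ, {ω | (k : ℝ) < φ ω}) = ∅ := by
    refine Set.eq_empty_of_forall_notMem fun ω hω => ?_
    obtain ⟨k, hk⟩ := exists_nat_gt (φ ω)
    exact lt_asymm hk (Set.mem_iInter.1 hω k)
  rw [h2, measure_empty] at h1
  obtain ⟨k, hk⟩ := (h1.eventually (ge_mem_nhds (ENNReal.ofReal_pos.2 hδ))).exists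
  refine ⟨k, fun H hH => ENNReal.toReal_le_of_le_ofReal hδ.le ?_⟩
  exact (measure_mono fun ω hω => lt_of_le_of_lt hH hω).trans hk

theorem norm_integral_flow_le {E : Type*} [NormedAddCommGroup E] [NormedSpace ℝ E]
    (hτ : IsBoundedAwayFromZero τ) {h : Suspension τ → E} {C : ℝ} (hC : ∀ y, ‖h y‖ ≤ C) {T : ℝ}
    (hT : 0 ≤ T) (y : Suspension τ) :
    ‖∫ t in (0 : ℝ)..T, h (flow hτ t.toNNReal y)‖ ≤ C * T := by
  refine (intervalIntegral.norm_integral_le_of_norm_le_const fun u _ => hC _).trans_eq ?_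
  rw [sub_zero, abs_of_nonneg hT]

theorem exists_periodic_near {E : Type*} [NormedAddCommGroup E] [NormedSpace ℝ E]
    [CompleteSpace E] [MeasurableSpace E] [BorelSpace E] [SecondCountableTopology E]
    (hB : IsTransitionMatrix B) (hB' : IsTransitive B) (hτ : IsBoundedAwayFromZero τ)
    (hc : Continuous τ) (hv : variation 2 τ < ∞) {f : Suspension τ → E} (hf : Continuous f)
    {C : ℝ} (hC0 : 0 ≤ C) (hC : ∀ y, ‖f y‖ ≤ C) {ν : ProbabilityMeasure (Suspension τ)}
    (hν : ν ∈ invariantMeasures hτ) {ε : ℝ} (hε : 0 < ε) :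
    ∃ (p : Shift B) (n : ℕ) (K : ℝ), 0 < n ∧ 0 < K ∧ shiftMap^[n] p = p ∧
      ‖K⁻¹ • birkhoffSum shiftMap (fiberIntegral hτ f) n p -
        ∫ y, f y ∂(ν : Measure (Suspension τ))‖ ≤ 6 * ε := by
  obtain ⟨V, hV0, hV⟩ := exists_variation_bound hv
  obtain ⟨c, hc0, hcτ⟩ := id hτ
  set F := fiberIntegral hτ f
  set μ := (ν : Measure (Suspension τ))
  have hF : ∀ x, ‖F x‖ ≤ C * τ x := norm_fiberIntegral_le hτ hC
  have hFc : Continuous F := continuous_fiberIntegral hτ hc hf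
  set D := C * (2 + V / c)
  have hD0 : 0 ≤ D := by positivity
  have hgm : ∀ L, 2 ≤ L → Measurable (oscDensity hτ F L) := fun L hL =>
    measurable_oscDensity hτ hc (measurable_osc hF hC0 hV hL hFc)
  have hgD : ∀ L, 2 ≤ L → ∀ y, ‖oscDensity hτ F L y‖ ≤ D := fun L hL =>
    norm_oscDensity_le hτ hF hC0 hV0 hV hL hc0 hcτ
  -- Dominated convergence: the oscillation tends to `0` only pointwise, but `D` bounds all the
  -- densities.
  obtain ⟨L, hL, hLε⟩ : ∃ L, 2 ≤ L ∧ ∫ y, oscDensity hτ F L y ∂μ ≤ ε := by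
    have h1 : Tendsto (fun L => ∫ y, oscDensity hτ F (L + 2) y ∂μ) atTop (𝓝 (∫ _, (0 : ℝ) ∂μ)) := by
      refine tendsto_integral_of_dominated_convergence (fun _ => D)
        (fun L => (hgm (L + 2) (by omega)).aestronglyMeasurable) (integrable_const _)
        (fun L => Eventually.of_forall (hgD (L + 2) (by omega)))
        (Eventually.of_forall fun y => ?_)
      have := ((tendsto_osc hFc (lift hτ y).1).comp (tendsto_add_atTop_nat 2)).div_const
        (τ (lift hτ y).1)
      rwa [zero_div] at this
    rw [integral_zero] at h1
    obtain ⟨L, hL⟩ := (h1.eventually (ge_mem_nhds hε)).exists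
    exact ⟨L + 2, by omega, hL⟩
  set g := oscDensity hτ F L
  obtain ⟨κ₁, κ₂, hκ₁, hκ₂, hloop⟩ := exists_loopApprox hB hB' hτ hc hf hC0 hC hV hL (hgD L hL)
  obtain ⟨δ, hδ0, hδ1, hδ⟩ : ∃ δ : ℝ, 0 < δ ∧ δ < 1 ∧ 2 * (C + D) * δ ≤ ε := by
    refine ⟨min (1 / 2) (ε / (2 * (C + D) + 1)), by positivity,
      (min_le_left _ _).trans_lt (by norm_num), ?_⟩
    calc 2 * (C + D) * min (1 / 2) (ε / (2 * (C + D) + 1))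
        ≤ (2 * (C + D) + 1) * (ε / (2 * (C + D) + 1)) := by
          gcongr
          · linarith
          · exact min_le_right _ _
      _ = ε := by field_simp
  have hx : Measurable fun y : Suspension τ => (lift hτ y).1 := (measurable_lift hτ hc).fst
  obtain ⟨H₁, hH₁⟩ := exists_measureReal_lt_le μ (hκ₁.comp hx) (half_pos hδ0)
  obtain ⟨H₂, hH₂⟩ := exists_measureReal_lt_le μ (hκ₂.comp hx) (half_pos hδ0)
  set H := max (max H₁ H₂) 0
  have hH0 : 0 ≤ H := le_max_right _ _
  -- `T` is chosen after `H`, so that the connecting cost of at most `2 * H` per segment is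
  -- negligible per unit time.
  obtain ⟨T, hT, hTH⟩ : ∃ T : ℝ, 0 < T ∧ 2 * H ≤ ε * T := by
    refine ⟨2 * H / ε + 1, by positivity, ?_⟩
    rw [mul_add, mul_div_cancel₀ _ hε.ne']
    linarith
  have hflow := (continuous_flow hτ hc T.toNNReal).measurable
  set G : Set (Suspension τ) := {y | κ₁ (lift hτ y).1 ≤ H} ∩
    flow hτ T.toNNReal ⁻¹' {y | κ₂ (lift hτ y).1 ≤ H} with hGdef
  have hm₁ : MeasurableSet {y | κ₁ (lift hτ y).1 ≤ H} :=
    measurableSet_le (hκ₁.comp hx) measurable_const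
  have hm₂ : MeasurableSet {y | κ₂ (lift hτ y).1 ≤ H} :=
    measurableSet_le (hκ₂.comp hx) measurable_const
  have hGm : MeasurableSet G := hm₁.inter (hflow hm₂)
  have hGδ : μ.real Gᶜ ≤ δ := by
    have e1 : {y | κ₁ (lift hτ y).1 ≤ H}ᶜ = {y | H < κ₁ (lift hτ y).1} := by
      ext y; simp
    have e2 : {y | κ₂ (lift hτ y).1 ≤ H}ᶜ = {y | H < κ₂ (lift hτ y).1} := by
      ext y; simp
    rw [hGdef, Set.compl_inter, ← Set.preimage_compl, e1, e2]
    refine (measureReal_union_le _ _).trans ?_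
    -- By invariance the end of a segment is distributed like its start, so `H` controls it for
    -- every `T`.
    have e3 : μ.real (flow hτ T.toNNReal ⁻¹' {y | H < κ₂ (lift hτ y).1}) =
        μ.real {y | H < κ₂ (lift hτ y).1} :=
      congrArg ENNReal.toReal (hν T.toNNReal _ (e2 ▸ hm₂.compl))
    rw [e3]
    have e4 := hH₁ H ((le_max_left _ _).trans (le_max_left _ _))
    have e5 := hH₂ H ((le_max_right _ _).trans (le_max_left _ _))
    simp only [Function.comp_apply] at e4 e5
    linarith
  have hi₁ := integrable_integral_flow hτ hc hf.measurable hC μ hT.le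
  have hi₂ := integrable_integral_flow hτ hc (hgm L hL) (hgD L hL) μ hT.le
  have hbound : ∀ y, ‖((∫ t in (0 : ℝ)..T, f (flow hτ t.toNNReal y)),
      ∫ t in (0 : ℝ)..T, g (flow hτ t.toNNReal y))‖ ≤ (C + D) * T := by
    intro y
    rw [Prod.norm_def]
    refine max_le ((norm_integral_flow_le hτ hC hT.le y).trans ?_)
      ((norm_integral_flow_le hτ (hgD L hL) hT.le y).trans ?_) <;>
    · gcongr
      linarith
  -- One sample must serve both the integrals of `f` and the shadowing errors, hence the pair.
  obtain ⟨ι, _, _, y, hyG, hy⟩ := exists_sample μ (hi₁.prodMk hi₂) hbound hGm hGδ hδ1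
    (mul_pos hε hT)
  rw [integral_pair hi₁ hi₂, integral_integral_flow hτ hc hf.measurable hC hν hT.le,
    integral_integral_flow hτ hc (hgm L hL) (hgD L hL) hν hT.le] at hy
  have hy' : 2 * ((C + D) * T) * δ + ε * T ≤ 2 * ε * T := by
    have := mul_le_mul_of_nonneg_right hδ hT.le
    linarith
  set k := (Fintype.card ι : ℝ) with hk
  have hk0 : 0 < k := Nat.cast_pos.2 Fintype.card_pos
  have hyf := (norm_fst_le _).trans (hy.trans hy')
  have hyg := (norm_snd_le _).trans (hy.trans hy')
  simp only [Prod.fst_sub, Prod.snd_sub, Prod.smul_fst, Prod.smul_snd, Prod.fst_sum,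
    Prod.snd_sum] at hyf hyg
  obtain ⟨n, hn, hpath⟩ := exists_pathApprox_sum (F := F) (a := 0)
    (Finset.univ_nonempty (α := ι)) _ _ fun i _ => hloop (y i) T hT.le
  obtain ⟨p, hp, hpI⟩ := hpath.exists_periodic hn
  -- `k * T` is the total sampled time. Per unit of it, shadowing costs `3 * ε` (mean `ε` plus
  -- sampling error `2 * ε`), connections cost `ε`, and the sampling of `f` costs `2 * ε`.
  refine ⟨p, n, k * T, hn, by positivity, hp, ?_⟩
  set I := ∑ i, ∫ t in (0 : ℝ)..T, f (flow hτ t.toNNReal (y i))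
  set J := ∑ i, ∫ t in (0 : ℝ)..T, g (flow hτ t.toNNReal (y i))
  have h1 : ‖birkhoffSum shiftMap F n p - I‖ ≤ J + k * (2 * H) := by
    refine hpI.trans ?_
    rw [Finset.sum_add_distrib]
    refine add_le_add le_rfl ((Finset.sum_le_card_nsmul _ _ (2 * H) fun i _ => ?_).trans_eq ?_)
    · have a1 : κ₁ (lift hτ (y i)).1 ≤ H := (hyG i).1
      have a2 : κ₂ (lift hτ (flow hτ T.toNNReal (y i))).1 ≤ H := (hyG i).2
      linarith
    · simp [hk]
  have h2 : J ≤ k * (3 * ε * T) := by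
    rw [← inv_mul_le_iff₀ hk0]
    have := (le_abs_self _).trans hyg
    simp only [smul_eq_mul] at this
    have h3 := mul_le_mul_of_nonneg_left hLε hT.le
    linarith
  have h3 : (k * T)⁻¹ • birkhoffSum shiftMap F n p - ∫ y, f y ∂μ =
      (k * T)⁻¹ • (birkhoffSum shiftMap F n p - I) +
        T⁻¹ • (k⁻¹ • I - T • ∫ y, f y ∂μ) := by
    rw [smul_sub, smul_sub, smul_smul, smul_smul, inv_mul_cancel₀ hT.ne', one_smul, mul_inv,
      mul_comm T⁻¹ k⁻¹]
    abel
  rw [h3]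
  refine (norm_add_le _ _).trans ?_
  rw [norm_smul, norm_smul, norm_inv, norm_inv, Real.norm_of_nonneg hT.le,
    Real.norm_of_nonneg (by positivity : 0 ≤ k * T)]
  have h4 : (k * T)⁻¹ * ‖birkhoffSum shiftMap F n p - I‖ ≤ 4 * ε := by
    rw [inv_mul_le_iff₀ (by positivity)]
    have := mul_le_mul_of_nonneg_left hTH hk0.le
    linarith
  have h5 : T⁻¹ * ‖k⁻¹ • I - T • ∫ y, f y ∂μ‖ ≤ 2 * ε := by
    rw [inv_mul_le_iff₀ hT]
    linarith
  linarith

/-! ### Periodic orbit measures -/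

/-- A periodic function has the same integral over every window of length one period. -/
theorem integral_flow_orbit_of_periodic (hτ : IsBoundedAwayFromZero τ) (hc : Continuous τ)
    {p : Shift B} {n : ℕ} (hp : shiftMap^[n] p = p) {h : Suspension τ → ℝ} (hm : Measurable h)
    {C : ℝ} (hC : ∀ y, ‖h y‖ ≤ C) (t : ℝ≥0) :
    ∫ u in (0 : ℝ)..birkhoffSum shiftMap τ n p, h (flow hτ t (orbit hτ p u)) =
      ∫ u in (0 : ℝ)..birkhoffSum shiftMap τ n p, h (orbit hτ p u) := by
  set P := birkhoffSum shiftMap τ n p with hP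
  have hP0 : 0 ≤ P := Finset.sum_nonneg fun k _ => (hτ.pos _).le
  have hi := intervalIntegrable_orbit hτ hc hm hC p
  have h1 : ∫ u in (0 : ℝ)..P, h (flow hτ t (orbit hτ p u)) =
      ∫ u in (t : ℝ)..(t + P), h (orbit hτ p u) := by
    have e := intervalIntegral.integral_comp_add_left (a := 0) (b := P)
      (fun u => h (orbit hτ p u)) t
    rw [add_zero] at e
    rw [← e]
    refine intervalIntegral.integral_congr_Ioo_of_le hP0 fun u hu => ?_
    simp only [flow_orbit hτ t p hu.1.le, add_comm u]
  have h2 : ∫ u in P..(t + P), h (orbit hτ p u) = ∫ u in (0 : ℝ)..t, h (orbit hτ p u) := by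
    have e := intervalIntegral.integral_comp_add_left (a := 0) (b := t)
      (fun u => h (orbit hτ p u)) P
    rw [add_zero, add_comm P] at e
    rw [← e]
    refine intervalIntegral.integral_congr_Ioo_of_le t.2 fun u hu => ?_
    simp only [hP, orbit_birkhoffSum_add hτ n p hu.1.le, hp]
  have h3 := intervalIntegral.integral_add_adjacent_intervals (hi 0 t) (hi t (t + P))
  have h4 := intervalIntegral.integral_add_adjacent_intervals (hi 0 P) (hi P (t + P))
  rw [h1]
  linarith

/-- The measure is normalized Lebesgue measure on one period, pushed forward along the orbit; `n`
need not be the least period. A flow-invariant set contains the whole forward orbit of `(p, 0)` or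
misses it, whence ergodicity. -/
theorem exists_ergodic_of_periodic (hτ : IsBoundedAwayFromZero τ) (hc : Continuous τ)
    {p : Shift B} {n : ℕ} (hn : 0 < n) (hp : shiftMap^[n] p = p) :
    ∃ ν ∈ ergodicMeasures hτ, ∀ (h : Suspension τ → ℝ) (C : ℝ), Measurable h →
      (∀ y, ‖h y‖ ≤ C) → ∫ y, h y ∂(ν : Measure (Suspension τ)) =
        (birkhoffSum shiftMap τ n p)⁻¹ * birkhoffSum shiftMap (fiberIntegral hτ h) n p := by
  set P := birkhoffSum shiftMap τ n p
  have hP0 : 0 < P := Finset.sum_pos (fun k _ => hτ.pos _) ⟨0, Finset.mem_range.2 hn⟩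
  have ho : Measurable (orbit hτ p) :=
    ((continuous_orbit hτ hc).comp (Continuous.prodMk_right p)).measurable
  set m : Measure (Suspension τ) :=
    (ENNReal.ofReal P)⁻¹ • (volume.restrict (Set.Ioc 0 P)).map (orbit hτ p) with hm
  have hPE : ENNReal.ofReal P ≠ 0 := (ENNReal.ofReal_pos.2 hP0).ne'
  have hprob : IsProbabilityMeasure m := ⟨by
    rw [hm, Measure.smul_apply, Measure.map_apply ho MeasurableSet.univ]
    simp [ENNReal.inv_mul_cancel hPE ENNReal.ofReal_ne_top]⟩
  have hint : ∀ h : Suspension τ → ℝ, Measurable h →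
      ∫ y, h y ∂m = P⁻¹ * ∫ u in (0 : ℝ)..P, h (orbit hτ p u) := by
    intro h hh
    rw [hm, integral_smul_measure, integral_map ho.aemeasurable hh.aestronglyMeasurable,
      intervalIntegral.integral_of_le hP0.le, ENNReal.toReal_inv, ENNReal.toReal_ofReal hP0.le,
      smul_eq_mul]
  have hinv : ∀ (t : ℝ≥0) (A : Set (Suspension τ)), MeasurableSet A →
      m (flow hτ t ⁻¹' A) = m A := by
    intro t A hA
    have hfA : MeasurableSet (flow hτ t ⁻¹' A) := (continuous_flow hτ hc t).measurable hA
    have hind : Measurable (A.indicator (1 : Suspension τ → ℝ)) := measurable_one.indicator hA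
    rw [← measureReal_eq_measureReal_iff, ← integral_indicator_one hfA,
      ← integral_indicator_one hA, hint _ (measurable_one.indicator hfA), hint _ hind]
    congr 1
    refine integral_flow_orbit_of_periodic hτ hc hp hind (C := 1) (fun y => ?_) t
    exact (norm_indicator_le_norm_self _ _).trans (by simp)
  refine ⟨⟨m, hprob⟩, ⟨hinv, fun A hA hA' => ?_⟩, fun h C hh hC => ?_⟩
  · have hmem : ∀ u : ℝ, 0 ≤ u → (orbit hτ p u ∈ A ↔ orbit hτ p 0 ∈ A) := by
      intro u hu
      conv_rhs => rw [← hA' u.toNNReal]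
      rw [Set.mem_preimage, flow_orbit hτ _ p le_rfl, zero_add, Real.coe_toNNReal u hu]
    have hzero : ∀ A : Set (Suspension τ), MeasurableSet A →
        (∀ u : ℝ, 0 ≤ u → orbit hτ p u ∉ A) → m A = 0 := by
      intro A hA h
      have hempty : orbit hτ p ⁻¹' A ∩ Set.Ioc 0 P = ∅ :=
        Set.eq_empty_of_forall_notMem fun u hu => h u hu.2.1.le hu.1
      rw [hm, Measure.smul_apply, Measure.map_apply ho hA, Measure.restrict_apply (ho hA), hempty]
      simp
    by_cases h0 : orbit hτ p 0 ∈ A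
    · right
      exact (prob_compl_eq_zero_iff (μ := m) hA).1
        (hzero _ hA.compl fun u hu hu' => hu' ((hmem u hu).2 h0))
    · left
      exact hzero A hA fun u hu hu' => h0 ((hmem u hu).1 hu')
  · exact (hint h hh).trans (by rw [birkhoffSum_fiberIntegral hτ hc hh hC])

end

section

variable {B : Matrix ℕ ℕ ℕ} {τ : Shift B → ℝ}

/-! ### Density -/

open scoped BoundedContinuousFunction

theorem fiberIntegral_one (hτ : IsBoundedAwayFromZero τ) :
    fiberIntegral hτ (fun _ => (1 : ℝ)) = τ := by
  funext x
  simp [fiberIntegral]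

theorem fiberIntegral_pi_apply (hτ : IsBoundedAwayFromZero τ) (hc : Continuous τ) {ι : Type*}
    [Fintype ι] {f : Suspension τ → ι → ℝ} (hf : Continuous f) (x : Shift B) (k : ι) :
    fiberIntegral hτ f x k = fiberIntegral hτ (fun y => f y k) x := by
  have h := (ContinuousLinearMap.proj (R := ℝ) (φ := fun _ : ι => ℝ) k).intervalIntegral_comp_comm
    (μ := volume) (f := fun u => f (orbit hτ x u)) (a := 0) (b := τ x)
    ((hf.comp ((continuous_orbit hτ hc).comp (Continuous.prodMk_right x))).intervalIntegrable _ _)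
  exact h.symm

theorem exists_ergodic_near (hB : IsTransitionMatrix B) (hB' : IsTransitive B)
    (hτ : IsBoundedAwayFromZero τ) (hc : Continuous τ) (hv : variation 2 τ < ∞)
    {ν : ProbabilityMeasure (Suspension τ)} (hν : ν ∈ invariantMeasures hτ)
    (S : Finset (Suspension τ →ᵇ ℝ)) {ε : ℝ} (hε : 0 < ε) :
    ∃ ν' ∈ ergodicMeasures hτ, ∀ f ∈ S,
      |∫ y, f y ∂(ν' : Measure (Suspension τ)) - ∫ y, f y ∂(ν : Measure (Suspension τ))| < ε := by
  classical
  -- The fiber integral of `1` is `τ`, so this coordinate compares the period `P` with the scale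
  -- `K`.
  set S' := insert 1 S
  set C : ℝ := ∑ f ∈ S', ‖f‖
  have hC0 : 0 ≤ C := Finset.sum_nonneg fun f _ => norm_nonneg f
  have hCf : ∀ f ∈ S', ∀ y, ‖f y‖ ≤ C := fun f hf y =>
    (f.norm_coe_le_norm y).trans (Finset.single_le_sum (fun f _ => norm_nonneg f) hf)
  let F : Suspension τ → S' → ℝ := fun y f => f.1 y
  have hF : Continuous F := continuous_pi fun f => f.1.continuous
  have hFC : ∀ y, ‖F y‖ ≤ C := fun y => (pi_norm_le_iff_of_nonneg hC0).2 fun f => hCf f.1 f.2 y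
  -- The final error is at most `6 * η` from `f` plus `C * (6 * η)` from replacing `K` by `P`; using
  -- `C + 2` in place of `C + 1` makes the inequality strict.
  set η := ε / (6 * (C + 2)) with hη
  have hη0 : 0 < η := by positivity
  obtain ⟨p, n, K, hn, hK, hp, hnear⟩ := exists_periodic_near hB hB' hτ hc hv hF hC0 hFC hν hη0
  obtain ⟨ν', hν', hint⟩ := exists_ergodic_of_periodic hτ hc hn hp
  have hFi : Integrable F (ν : Measure (Suspension τ)) :=
    Integrable.of_bound hF.measurable.aestronglyMeasurable C (Eventually.of_forall hFC)
  have hcoord : ∀ f ∈ S', |K⁻¹ * birkhoffSum shiftMap (fiberIntegral hτ f) n p -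
      ∫ y, f y ∂(ν : Measure (Suspension τ))| ≤ 6 * η := by
    intro f hf
    have h1 := (norm_le_pi_norm _ (⟨f, hf⟩ : S')).trans hnear
    have h2 : (∫ y, F y ∂(ν : Measure (Suspension τ))) ⟨f, hf⟩ =
        ∫ y, f y ∂(ν : Measure (Suspension τ)) :=
      ((ContinuousLinearMap.proj (R := ℝ) (φ := fun _ : S' => ℝ) ⟨f, hf⟩).integral_comp_comm
        hFi).symm
    have h3 : birkhoffSum shiftMap (fiberIntegral hτ F) n p ⟨f, hf⟩ =
        birkhoffSum shiftMap (fiberIntegral hτ f) n p := by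
      unfold birkhoffSum
      rw [Finset.sum_apply]
      exact Finset.sum_congr rfl fun i _ => fiberIntegral_pi_apply hτ hc hF _ _
    rwa [Pi.sub_apply, Pi.smul_apply, h2, h3, smul_eq_mul, Real.norm_eq_abs] at h1
  refine ⟨ν', hν', fun f hf => ?_⟩
  have hfS : f ∈ S' := Finset.mem_insert_of_mem hf
  have h1 := hcoord 1 (Finset.mem_insert_self _ _)
  have h2 := hcoord f hfS
  have hone : fiberIntegral hτ (1 : Suspension τ →ᵇ ℝ) = τ := fiberIntegral_one hτ
  have hone' : ∫ y, (1 : Suspension τ →ᵇ ℝ) y ∂(ν : Measure (Suspension τ)) = 1 := by simp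
  rw [hone, hone'] at h1
  have h3 := hint f C f.continuous.measurable (hCf f hfS)
  set P := birkhoffSum shiftMap τ n p
  set I := birkhoffSum shiftMap (fiberIntegral hτ f) n p
  have hP : 0 < P := Finset.sum_pos (fun k _ => hτ.pos _) ⟨0, Finset.mem_range.2 hn⟩
  have h4 : |P⁻¹ * I| ≤ C := by
    rw [← h3]
    have := norm_integral_le_of_norm_le_const (μ := (ν' : Measure (Suspension τ)))
      (Eventually.of_forall (hCf f hfS))
    simpa using this
  have h5 : P⁻¹ * I - K⁻¹ * I = -(P⁻¹ * I * (K⁻¹ * P - 1)) := by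
    field_simp
    ring
  have h6 : |P⁻¹ * I - K⁻¹ * I| ≤ C * (6 * η) := by
    rw [h5, abs_neg, abs_mul]
    exact mul_le_mul h4 h1 (abs_nonneg _) hC0
  rw [h3]
  have h7 := abs_sub_le (P⁻¹ * I) (K⁻¹ * I) (∫ y, f y ∂(ν : Measure (Suspension τ)))
  have h8 : 6 * η * (C + 2) = ε := by
    rw [hη]
    field_simp
  linarith

theorem mem_closure_ergodicMeasures (hB : IsTransitionMatrix B) (hB' : IsTransitive B)
    (hτ : IsBoundedAwayFromZero τ) (hc : Continuous τ) (hv : variation 2 τ < ∞)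
    {ν : ProbabilityMeasure (Suspension τ)} (hν : ν ∈ invariantMeasures hτ) :
    ν ∈ closure (ergodicMeasures hτ) := by
  classical
  -- Pairs of a finite test set and a precision form a directed set, and the approximants along it
  -- are a net converging to `ν`.
  choose m hm hm' using fun q : Finset (Suspension τ →ᵇ ℝ) × ℕ =>
    exists_ergodic_near hB hB' hτ hc hv hν q.1 (Nat.one_div_pos_of_nat (α := ℝ) (n := q.2))
  refine mem_closure_of_tendsto (f := m) (b := atTop) ?_ (Eventually.of_forall hm)
  refine ProbabilityMeasure.tendsto_iff_forall_integral_tendsto.2 fun f => ?_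
  refine Metric.tendsto_atTop.2 fun ε hε => ?_
  obtain ⟨N, hN⟩ := exists_nat_one_div_lt hε
  refine ⟨({f}, N), fun q hq => ?_⟩
  have h1 := hm' q f (hq.1 (Finset.mem_singleton_self f))
  have h2 : (1 : ℝ) / (q.2 + 1) ≤ 1 / (N + 1) := Nat.one_div_le_one_div hq.2
  rw [Real.dist_eq]
  linarith

end

end

end MarkovSuspension

theorem mainTheorem11 (B : Matrix ℕ ℕ ℕ) (hB : IsTransitionMatrix B) (hB' : IsTransitive B)
    (τ : Shift B → ℝ) (hτ : ClassR τ) :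
    Dense {ν : invariantMeasures hτ.boundedAwayFromZero |
      (ν : ProbabilityMeasure (Suspension τ)) ∈ ergodicMeasures hτ.boundedAwayFromZero} := by
  intro ν
  rw [closure_subtype]
  have hsub : ergodicMeasures hτ.boundedAwayFromZero ⊆ Subtype.val ''
      {ν : invariantMeasures hτ.boundedAwayFromZero |
        (ν : ProbabilityMeasure (Suspension τ)) ∈ ergodicMeasures hτ.boundedAwayFromZero} :=
    fun μ hμ => ⟨⟨μ, hμ.1⟩, hμ, rfl⟩
  exact closure_mono hsub (mem_closure_ergodicMeasures hB hB' hτ.boundedAwayFromZero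
    hτ.uniformContinuous.continuous hτ.variation_two ν.2)
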